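/- Let $k$ be a field and let $C$ be a co-commutative $k$-coalgebra, with comultiplication $\Delta(c)=\sum c_1\otimes c_2$ and counit $\varepsilon$. Its dual $C^*=\mathrm{Hom}_k(C,k)$ is an algebra under the convolution product $(f*g)(c)=\sum f(c_1)g(c_2)$, and it acts on $C$ by $fc=\sum c_1f(c_2)$ and $cf=\sum f(c_1)c_2$. For an idempotent $e\in C^*$, $Ce$ is a right subcomodule of $C$, and $eCe$ is a coalgebra with comultiplication $ece\mapsto\sum ec_1e\otimes ec_2e$ and counit the restriction of $\varepsilon$. Let $\{S_i : i\in I\}$ be a complete set of representatives of the isomorphism types of simple right $C$-comodules, and let $\{e_i : i\in I\}$ be a basic set of idempotents for $C$, that is, a set of orthogonal idempotents of $C^*$ such that $Ce_i$ is an injective hull of $S_i$ in the category of right $C$-comodules for every $i\in I$. A right $C$-comodule $M$ is quasi-finite if the space $\mathrm{Com}_C(S,M)$ of comodule morphisms is finite-dimensional for every simple right $C$-comodule $S$, and strictly quasi-finite if $M/M'$ is quasi-finite for every subcomodule $M'\subseteq M$. A coalgebra is strictly quasi-finite (respectively artinian) if, as a right comodule over itself, it is strictly quasi-finite (respectively satisfies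 the descending chain condition on subcomodules). A coalgebra is colocal if its dual algebra is a local algebra. The following statements are equivalent: (i) $C$ is strictly quasi-finite; (ii) the coalgebra $e_iCe_i$ is artinian for every $i\in I$; (iii) $C$ is isomorphic, as a coalgebra, to a direct sum of co-commutative artinian colocal coalgebras; (iv) the algebra $(e_iCe_i)^*$ is noetherian for every $i\in I$. -/

import Mathlib

open TensorProduct Coalgebra

universe u v w

/-- The dual algebra `C^* = Hom_k(C, k)` of a coalgebra `C`, with the convolution product
`(f * g)(c) = ∑ f(c₁) g(c₂)` and unit the counit of `C`. -/
abbrev DualAlg (k : Type u) (C : Type v) [Field k] [AddCommGroup C] [Module k C] :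
    Type (max u v) :=
  WithConv (C →ₗ[k] k)

/-! ### Right comodules -/

/-- A right `C`-comodule structure on a vector space `M`. -/
structure RightComodule (k : Type u) (C : Type v) (M : Type w) [Field k]
    [AddCommGroup C] [Module k C] [Coalgebra k C] [AddCommGroup M] [Module k M] where
  /-- the structure map `M → M ⊗ C` -/
  coact : M →ₗ[k] M ⊗[k] C
  coassoc : (TensorProduct.assoc k M C C).toLinearMap ∘ₗ coact.rTensor C ∘ₗ coact =
    (comul : C →ₗ[k] C ⊗[k] C).lTensor M ∘ₗ coact
  counit_coact : (counit : C →ₗ[k] k).lTensor M ∘ₗ coact = (TensorProduct.mk k M k).flip 1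

namespace RightComodule

lemma rTensor_subtype_injective {k : Type u} {C : Type v} {M : Type w} [Field k]
    [AddCommGroup C] [Module k C] [AddCommGroup M] [Module k M] (X : Submodule k M) :
    Function.Injective (X.subtype.rTensor C) :=
  Module.Flat.rTensor_preserves_injective_linearMap _ X.injective_subtype

variable {k : Type u} {C : Type v} [Field k] [AddCommGroup C] [Module k C] [Coalgebra k C]
variable {M N : Type w} [AddCommGroup M] [Module k M] [AddCommGroup N] [Module k N]

variable (k C) in
/-- The coalgebra `C` as a right comodule over itself. -/
def regular : RightComodule k C C where
  coact := comul
  coassoc := Coalgebra.coassoc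
  counit_coact := Coalgebra.lTensor_counit_comp_comul

/-- `Com_C(M, N)`: the vector space of morphisms of right comodules. -/
def hom (ρ : RightComodule k C M) (σ : RightComodule k C N) : Submodule k (M →ₗ[k] N) where
  carrier := {f | σ.coact ∘ₗ f = f.rTensor C ∘ₗ ρ.coact}
  add_mem' {f g} hf hg := by
    simp only [Set.mem_ofPred_eq] at *
    rw [LinearMap.comp_add, hf, hg, LinearMap.rTensor_add, LinearMap.add_comp]
  zero_mem' := by simp
  smul_mem' c f hf := by
    simp only [Set.mem_ofPred_eq] at *
    rw [LinearMap.comp_smul, hf, LinearMap.rTensor_smul, LinearMap.smul_comp]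

/-- The subspace `X` of `M` is a subcomodule: the structure map sends `X` into `X ⊗ C`. -/
def IsSubcomodule (ρ : RightComodule k C M) (X : Submodule k M) : Prop :=
  ∀ x ∈ X, ρ.coact x ∈ LinearMap.range (X.subtype.rTensor C)

/-- The structure map of a subcomodule. -/
noncomputable def restrictCoact (ρ : RightComodule k C M) (X : Submodule k M)
    (hX : ρ.IsSubcomodule X) : X →ₗ[k] X ⊗[k] C :=
  (LinearEquiv.ofInjective _ (rTensor_subtype_injective (C := C) X)).symm.toLinearMap ∘ₗ
    (ρ.coact ∘ₗ X.subtype).codRestrict _ (fun x => hX x x.2)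

lemma rTensor_subtype_restrictCoact (ρ : RightComodule k C M) (X : Submodule k M)
    (hX : ρ.IsSubcomodule X) :
    X.subtype.rTensor C ∘ₗ ρ.restrictCoact X hX = ρ.coact ∘ₗ X.subtype := by
  ext x
  exact LinearEquiv.ofInjective_symm_apply (f := X.subtype.rTensor C)
    (h := rTensor_subtype_injective (C := C) X)
    ((ρ.coact ∘ₗ X.subtype).codRestrict _ (fun x => hX x x.2) x)

/-- A subcomodule, as a comodule. -/
noncomputable def restrict (ρ : RightComodule k C M) (X : Submodule k M)
    (hX : ρ.IsSubcomodule X) : RightComodule k C X where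
  coact := ρ.restrictCoact X hX
  coassoc := by
    have key := ρ.rTensor_subtype_restrictCoact X hX
    have inj : Function.Injective (X.subtype.rTensor (C ⊗[k] C)) :=
      Module.Flat.rTensor_preserves_injective_linearMap _ X.injective_subtype
    rw [← LinearMap.cancel_left inj]
    have h1 : X.subtype.rTensor (C ⊗[k] C) ∘ₗ (TensorProduct.assoc k X C C).toLinearMap =
        (TensorProduct.assoc k M C C).toLinearMap ∘ₗ (X.subtype.rTensor C).rTensor C := by
      ext; simp
    have h2 : X.subtype.rTensor (C ⊗[k] C) ∘ₗ (comul : C →ₗ[k] C ⊗[k] C).lTensor X =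
        (comul : C →ₗ[k] C ⊗[k] C).lTensor M ∘ₗ X.subtype.rTensor C := by
      ext; simp
    rw [← LinearMap.comp_assoc, h1, ← LinearMap.comp_assoc _ (LinearMap.lTensor _ _), h2,
      LinearMap.comp_assoc _ _ (LinearMap.lTensor _ _), key,
      ← LinearMap.comp_assoc _ _ (LinearMap.lTensor _ _), ← ρ.coassoc]
    simp only [LinearMap.comp_assoc]
    rw [← LinearMap.comp_assoc _ (LinearMap.rTensor C _) (LinearMap.rTensor C _),
      ← LinearMap.rTensor_comp, key, LinearMap.rTensor_comp]
    simp only [LinearMap.comp_assoc]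
    rw [key]
  counit_coact := by
    have key := ρ.rTensor_subtype_restrictCoact X hX
    have inj : Function.Injective (X.subtype.rTensor k) :=
      Module.Flat.rTensor_preserves_injective_linearMap _ X.injective_subtype
    rw [← LinearMap.cancel_left inj]
    have h2 : X.subtype.rTensor k ∘ₗ (counit : C →ₗ[k] k).lTensor X =
        (counit : C →ₗ[k] k).lTensor M ∘ₗ X.subtype.rTensor C := by
      ext; simp
    rw [← LinearMap.comp_assoc, h2, LinearMap.comp_assoc, key, ← LinearMap.comp_assoc,
      ρ.counit_coact]
    ext; simp

lemma le_ker_quotientCoact (ρ : RightComodule k C M) (X : Submodule k M)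
    (hX : ρ.IsSubcomodule X) : X ≤ LinearMap.ker (X.mkQ.rTensor C ∘ₗ ρ.coact) := by
  intro x hx
  obtain ⟨y, hy⟩ := hX x hx
  have h0 : X.mkQ ∘ₗ X.subtype = 0 := by ext; simp
  rw [LinearMap.mem_ker, LinearMap.comp_apply, ← hy, ← LinearMap.comp_apply,
    ← LinearMap.rTensor_comp, h0, LinearMap.rTensor_zero, LinearMap.zero_apply]

/-- The factor comodule `M / X` of `M` by a subcomodule `X`. -/
noncomputable def quotient (ρ : RightComodule k C M) (X : Submodule k M)
    (hX : ρ.IsSubcomodule X) : RightComodule k C (M ⧸ X) where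
  coact := X.liftQ (X.mkQ.rTensor C ∘ₗ ρ.coact) (ρ.le_ker_quotientCoact X hX)
  coassoc := by
    set q := X.liftQ (X.mkQ.rTensor C ∘ₗ ρ.coact) (ρ.le_ker_quotientCoact X hX)
    have key : q ∘ₗ X.mkQ = X.mkQ.rTensor C ∘ₗ ρ.coact := Submodule.liftQ_mkQ _ _ _
    rw [← LinearMap.cancel_right X.mkQ_surjective]
    have h1 : (TensorProduct.assoc k (M ⧸ X) C C).toLinearMap ∘ₗ
        (X.mkQ.rTensor C).rTensor C =
        X.mkQ.rTensor (C ⊗[k] C) ∘ₗ (TensorProduct.assoc k M C C).toLinearMap := by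
      ext; simp
    have h2 : (comul : C →ₗ[k] C ⊗[k] C).lTensor (M ⧸ X) ∘ₗ X.mkQ.rTensor C =
        X.mkQ.rTensor (C ⊗[k] C) ∘ₗ (comul : C →ₗ[k] C ⊗[k] C).lTensor M := by
      ext; simp
    simp only [LinearMap.comp_assoc]
    rw [key, ← LinearMap.comp_assoc _ _ (LinearMap.lTensor _ _), h2, LinearMap.comp_assoc,
      ← ρ.coassoc, ← LinearMap.comp_assoc _ (LinearMap.rTensor C _) (LinearMap.rTensor C _),
      ← LinearMap.rTensor_comp, key, LinearMap.rTensor_comp, LinearMap.comp_assoc,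
      ← LinearMap.comp_assoc, h1, LinearMap.comp_assoc]
  counit_coact := by
    set q := X.liftQ (X.mkQ.rTensor C ∘ₗ ρ.coact) (ρ.le_ker_quotientCoact X hX)
    have key : q ∘ₗ X.mkQ = X.mkQ.rTensor C ∘ₗ ρ.coact := Submodule.liftQ_mkQ _ _ _
    rw [← LinearMap.cancel_right X.mkQ_surjective]
    have h2 : (counit : C →ₗ[k] k).lTensor (M ⧸ X) ∘ₗ X.mkQ.rTensor C =
        X.mkQ.rTensor k ∘ₗ (counit : C →ₗ[k] k).lTensor M := by
      ext; simp
    rw [LinearMap.comp_assoc, key, ← LinearMap.comp_assoc, h2, LinearMap.comp_assoc,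
      ρ.counit_coact]
    ext; simp

/-- `M` is a simple comodule: it is nonzero and its only subcomodules are `0` and `M`. -/
def IsSimple (ρ : RightComodule k C M) : Prop :=
  Nontrivial M ∧ ∀ X : Submodule k M, ρ.IsSubcomodule X → X = ⊥ ∨ X = ⊤

/-- `M` is an artinian object of the category of right comodules: the descending chain condition
holds for its subcomodules. -/
def IsArtinian (ρ : RightComodule k C M) : Prop :=
  WellFoundedLT {X : Submodule k M // ρ.IsSubcomodule X}

/-- `M` and `N` are isomorphic comodules. -/
def Iso (ρ : RightComodule k C M) (σ : RightComodule k C N) : Prop :=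
  ∃ f : M ≃ₗ[k] N, f.toLinearMap ∈ ρ.hom σ

end RightComodule

namespace RightComodule

variable {k : Type u} {C : Type v} [Field k] [AddCommGroup C] [Module k C] [Coalgebra k C]
variable {M : Type v} [AddCommGroup M] [Module k M]
variable {N : Type v} [AddCommGroup N] [Module k N]

/-- `M` is quasi-finite: `Com_C(S, M)` is finite-dimensional for every simple comodule `S`.
(A simple comodule embeds in `C`, hence has a copy in the universe of `C`.) -/
def IsQuasiFinite (ρ : RightComodule k C M) : Prop :=
  ∀ (S : Type v) [AddCommGroup S] [Module k S] (σ : RightComodule k C S),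
    σ.IsSimple → FiniteDimensional k (σ.hom ρ)

/-- `M` is strictly quasi-finite: all its factor comodules are quasi-finite. -/
def IsStrictlyQuasiFinite (ρ : RightComodule k C M) : Prop :=
  ∀ (X : Submodule k M) (hX : ρ.IsSubcomodule X), (ρ.quotient X hX).IsQuasiFinite

/-- `E` is an injective object of the category of right comodules. -/
def IsInjective (ρ : RightComodule k C M) : Prop :=
  ∀ (X Y : Type v) [AddCommGroup X] [Module k X] [AddCommGroup Y] [Module k Y]
    (σ : RightComodule k C X) (τ : RightComodule k C Y),
    ∀ i ∈ σ.hom τ, Function.Injective i → ∀ g ∈ σ.hom ρ, ∃ h ∈ τ.hom ρ, h ∘ₗ i = g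

/-- The comodule `N` (with structure `σ`) is an injective hull of `M` (with structure `ρ`):
it is injective and `M` embeds in it as an essential subcomodule. -/
def IsInjectiveHull (ρ : RightComodule k C M) (σ : RightComodule k C N) : Prop :=
  σ.IsInjective ∧ ∃ f ∈ ρ.hom σ, Function.Injective f ∧
    ∀ X : Submodule k N, σ.IsSubcomodule X → X ⊓ LinearMap.range f = ⊥ → X = ⊥

end RightComodule

/-- `(S i)_{i ∈ I}` is a complete set of representatives of the isomorphism types of simple right
`C`-comodules. -/
structure IsCompleteSetOfSimples {k : Type u} {C : Type v} [Field k] [AddCommGroup C] [Module k C]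
    [Coalgebra k C] {I : Type w} {S : I → Type v} [∀ i, AddCommGroup (S i)]
    [∀ i, Module k (S i)] (σ : ∀ i, RightComodule k C (S i)) : Prop where
  simple : ∀ i, (σ i).IsSimple
  eq_of_iso : ∀ i j, (σ i).Iso (σ j) → i = j
  complete : ∀ (T : Type v) [AddCommGroup T] [Module k T] (τ : RightComodule k C T),
    τ.IsSimple → ∃ i, τ.Iso (σ i)

/-! ### The actions of the dual algebra, and the coalgebras `eCe` -/

section Corner

variable {k : Type u} {C : Type v} [Field k] [AddCommGroup C] [Module k C] [Coalgebra k C]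

/-- The left action `c ↦ e c = ∑ c₁ e(c₂)` of `e ∈ C^*` on `C`. -/
noncomputable def actL (e : DualAlg k C) : C →ₗ[k] C :=
  (TensorProduct.rid k C).toLinearMap ∘ₗ e.ofConv.lTensor C ∘ₗ comul

/-- The right action `c ↦ c e = ∑ e(c₁) c₂` of `e ∈ C^*` on `C`. -/
noncomputable def actR (e : DualAlg k C) : C →ₗ[k] C :=
  (TensorProduct.lid k C).toLinearMap ∘ₗ e.ofConv.rTensor C ∘ₗ comul

lemma comul_comp_actR (e : DualAlg k C) :
    (comul : C →ₗ[k] C ⊗[k] C) ∘ₗ actR e = (actR e).rTensor C ∘ₗ comul := by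
  have h : (comul : C →ₗ[k] C ⊗[k] C) ∘ₗ (TensorProduct.lid k C).toLinearMap ∘ₗ
      e.ofConv.rTensor C = ((TensorProduct.lid k C).toLinearMap ∘ₗ
      e.ofConv.rTensor C).rTensor C ∘ₗ (TensorProduct.assoc k C C C).symm.toLinearMap ∘ₗ
      (comul : C →ₗ[k] C ⊗[k] C).lTensor C := by
    ext a b
    simp only [TensorProduct.AlgebraTensorModule.curry_apply, LinearMap.restrictScalars_self,
      TensorProduct.curry_apply, LinearMap.comp_apply, LinearEquiv.coe_coe,
      LinearMap.rTensor_tmul, LinearMap.lTensor_tmul, TensorProduct.lid_tmul, map_smul]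
    induction (comul b : C ⊗[k] C) with
    | zero => simp
    | tmul x y => simp [TensorProduct.smul_tmul']
    | add x y hx hy => simp only [smul_add, TensorProduct.tmul_add, map_add, hx, hy]
  ext c
  have := LinearMap.congr_fun h (comul c)
  simp only [LinearMap.comp_apply, LinearEquiv.coe_coe, Coalgebra.coassoc_symm_apply] at this
  simp only [actR, LinearMap.comp_apply, LinearEquiv.coe_coe]
  rw [this, LinearMap.rTensor_comp_apply]
  simp [LinearMap.rTensor_comp]

lemma comul_comp_actL (e : DualAlg k C) :
    (comul : C →ₗ[k] C ⊗[k] C) ∘ₗ actL e = (actL e).lTensor C ∘ₗ comul := by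
  have h : (comul : C →ₗ[k] C ⊗[k] C) ∘ₗ (TensorProduct.rid k C).toLinearMap ∘ₗ
      e.ofConv.lTensor C = ((TensorProduct.rid k C).toLinearMap ∘ₗ
      e.ofConv.lTensor C).lTensor C ∘ₗ (TensorProduct.assoc k C C C).toLinearMap ∘ₗ
      (comul : C →ₗ[k] C ⊗[k] C).rTensor C := by
    ext a b
    simp only [TensorProduct.AlgebraTensorModule.curry_apply, LinearMap.restrictScalars_self,
      TensorProduct.curry_apply, LinearMap.comp_apply, LinearEquiv.coe_coe,
      LinearMap.rTensor_tmul, LinearMap.lTensor_tmul, TensorProduct.rid_tmul, map_smul]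
    induction (comul a : C ⊗[k] C) with
    | zero => simp
    | tmul x y => simp
    | add x y hx hy => simp only [smul_add, TensorProduct.add_tmul, map_add, hx, hy]
  ext c
  have := LinearMap.congr_fun h (comul c)
  simp only [LinearMap.comp_apply, LinearEquiv.coe_coe, Coalgebra.coassoc_apply] at this
  simp only [actL, LinearMap.comp_apply, LinearEquiv.coe_coe]
  rw [this, LinearMap.lTensor_comp_apply]
  simp [LinearMap.lTensor_comp]

/-- The subspace `Ce` of `C`. -/
noncomputable abbrev leftIdealSpace (e : DualAlg k C) : Submodule k C := LinearMap.range (actR e)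

lemma leftIdealSpace_isSubcomodule (e : DualAlg k C) :
    (RightComodule.regular k C).IsSubcomodule (leftIdealSpace e) := by
  rintro _ ⟨c, rfl⟩
  have h := LinearMap.congr_fun (comul_comp_actR e) c
  simp only [LinearMap.comp_apply] at h
  change comul (actR e c) ∈ _
  rw [h]
  refine ⟨(actR e).rangeRestrict.rTensor C (comul c), ?_⟩
  rw [← LinearMap.rTensor_comp_apply]
  rfl

/-- `Ce` as a right `C`-comodule. -/
noncomputable def leftIdealComodule (e : DualAlg k C) : RightComodule k C (leftIdealSpace e) :=
  (RightComodule.regular k C).restrict _ (leftIdealSpace_isSubcomodule e)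

/-- The map `c ↦ e c e = ∑ e(c₁) c₂ e(c₃)`. -/
noncomputable def sandwich (e : DualAlg k C) : C →ₗ[k] C := actR e ∘ₗ actL e

/-- The subspace `eCe` of `C`, for an idempotent `e` of `C^*`. -/
def Corner (e : DualAlg k C) (_he : IsIdempotentElem e) : Type v := LinearMap.range (sandwich e)

variable (e : DualAlg k C) (he : IsIdempotentElem e)

noncomputable instance : AddCommGroup (Corner e he) :=
  inferInstanceAs (AddCommGroup (LinearMap.range (sandwich e)))

noncomputable instance : Module k (Corner e he) :=
  inferInstanceAs (Module k (LinearMap.range (sandwich e)))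

namespace Corner

/-- The inclusion `eCe → C`. -/
noncomputable def incl : Corner e he →ₗ[k] C := (LinearMap.range (sandwich e)).subtype

/-- The surjection `C → eCe`, `c ↦ e c e`. -/
noncomputable def proj : C →ₗ[k] Corner e he := (sandwich e).rangeRestrict

lemma incl_comp_proj : incl e he ∘ₗ proj e he = sandwich e := rfl

lemma proj_surjective : Function.Surjective (proj e he) :=
  LinearMap.surjective_rangeRestrict _

lemma incl_injective : Function.Injective (incl e he) := Subtype.val_injective

lemma actL_actR (c : C) : actL e (actR e c) = actR e (actL e c) := by
  have h := LinearMap.congr_fun (comul_comp_actR e) c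
  simp only [LinearMap.comp_apply] at h
  conv_lhs => rw [actL]
  conv_rhs => rw [actL]
  simp only [LinearMap.comp_apply, LinearEquiv.coe_coe]
  rw [h]
  induction (comul c : C ⊗[k] C) with
  | zero => simp
  | tmul x y => simp
  | add x y hx hy => simp only [map_add, hx, hy]

lemma counit_actR (c : C) : counit (R := k) (actR e c) = e.ofConv c := by
  have h := Coalgebra.lTensor_counit_comul (R := k) c
  apply_fun (fun t => (TensorProduct.lid k k) (e.ofConv.rTensor k t)) at h
  simp only [LinearMap.rTensor_tmul, TensorProduct.lid_tmul, smul_eq_mul, mul_one] at h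
  rw [← h, actR]
  simp only [LinearMap.comp_apply, LinearEquiv.coe_coe]
  induction (comul c : C ⊗[k] C) with
  | zero => simp
  | tmul x y => simp
  | add x y hx hy => simp only [map_add, hx, hy]

lemma apply_actL (hI : IsIdempotentElem e) (c : C) : e.ofConv (actL e c) = e.ofConv c := by
  have h : (e * e).ofConv c = e.ofConv c := by rw [hI.eq]
  rw [← h]
  change _ = (e * e) c
  rw [LinearMap.convMul_apply, actL]
  simp only [LinearMap.comp_apply, LinearEquiv.coe_coe]
  induction (comul c : C ⊗[k] C) with
  | zero => simp
  | tmul x y => simp [mul_comm]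
  | add x y hx hy => simp only [map_add, hx, hy]

lemma apply_actR (hI : IsIdempotentElem e) (c : C) : e.ofConv (actR e c) = e.ofConv c := by
  have h : (e * e).ofConv c = e.ofConv c := by rw [hI.eq]
  rw [← h]
  change _ = (e * e) c
  rw [LinearMap.convMul_apply, actR]
  simp only [LinearMap.comp_apply, LinearEquiv.coe_coe]
  induction (comul c : C ⊗[k] C) with
  | zero => simp
  | tmul x y => simp
  | add x y hx hy => simp only [map_add, hx, hy]

lemma actL_actL (hI : IsIdempotentElem e) (c : C) : actL e (actL e c) = actL e c := by
  have h := LinearMap.congr_fun (comul_comp_actL e) c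
  simp only [LinearMap.comp_apply] at h
  have h' : actL e (actL e c) =
      TensorProduct.rid k C (e.ofConv.lTensor C (comul (actL e c))) := rfl
  rw [h', h]
  conv_rhs => rw [actL]
  simp only [LinearMap.comp_apply, LinearEquiv.coe_coe]
  induction (comul c : C ⊗[k] C) with
  | zero => simp
  | tmul x y => simp [apply_actL e hI]
  | add x y hx hy => simp only [map_add, hx, hy]

lemma actR_actR (hI : IsIdempotentElem e) (c : C) : actR e (actR e c) = actR e c := by
  have h := LinearMap.congr_fun (comul_comp_actR e) c
  simp only [LinearMap.comp_apply] at h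
  have h' : actR e (actR e c) =
      TensorProduct.lid k C (e.ofConv.rTensor C (comul (actR e c))) := rfl
  rw [h', h]
  conv_rhs => rw [actR]
  simp only [LinearMap.comp_apply, LinearEquiv.coe_coe]
  induction (comul c : C ⊗[k] C) with
  | zero => simp
  | tmul x y => simp [apply_actR e hI]
  | add x y hx hy => simp only [map_add, hx, hy]

lemma proj_actL (c : C) : proj e he (actL e c) = proj e he c := by
  apply incl_injective
  change actR e (actL e (actL e c)) = actR e (actL e c)
  rw [actL_actL e he]

lemma proj_actR (c : C) : proj e he (actR e c) = proj e he c := by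
  apply incl_injective
  change actR e (actL e (actR e c)) = actR e (actL e c)
  rw [actL_actR, actR_actR e he]

/-- The comultiplication `x ↦ ∑ e x₁ e ⊗ e x₂ e` of `eCe`. -/
noncomputable def comulMap : Corner e he →ₗ[k] Corner e he ⊗[k] Corner e he :=
  TensorProduct.map (proj e he) (proj e he) ∘ₗ comul ∘ₗ incl e he

/-- The comultiplication of `eCe` is `ece ↦ ∑ e c₁ e ⊗ e c₂ e`. -/
lemma comulMap_comp_proj :
    comulMap e he ∘ₗ proj e he = TensorProduct.map (proj e he) (proj e he) ∘ₗ comul := by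
  ext c
  change TensorProduct.map (proj e he) (proj e he) (comul (actR e (actL e c))) = _
  have h := LinearMap.congr_fun (comul_comp_actR e) (actL e c)
  have h' := LinearMap.congr_fun (comul_comp_actL e) c
  simp only [LinearMap.comp_apply] at h h' ⊢
  rw [h, h']
  induction (comul c : C ⊗[k] C) with
  | zero => simp
  | tmul x y => simp [proj_actL, proj_actR]
  | add x y hx hy => simp only [map_add, hx, hy]

lemma counit_proj (c : C) : counit (R := k) (incl e he (proj e he c)) = e.ofConv c := by
  change counit (R := k) (actR e (actL e c)) = _
  rw [counit_actR, apply_actL e he]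

/-- The coalgebra `eCe`: its comultiplication is `ece ↦ ∑ e c₁ e ⊗ e c₂ e`, and its counit is the
restriction of the counit of `C`. -/
noncomputable instance : Coalgebra k (Corner e he) where
  comul := comulMap e he
  counit := counit ∘ₗ incl e he
  coassoc := by
    rw [← LinearMap.cancel_right (proj_surjective e he)]
    simp only [LinearMap.comp_assoc, comulMap_comp_proj]
    have h1 : (comulMap e he).rTensor (Corner e he) ∘ₗ
        TensorProduct.map (proj e he) (proj e he) =
        TensorProduct.map (TensorProduct.map (proj e he) (proj e he)) (proj e he) ∘ₗ
          (comul : C →ₗ[k] C ⊗[k] C).rTensor C := by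
      rw [LinearMap.rTensor_comp_map, comulMap_comp_proj, LinearMap.map_comp_rTensor]
    have h2 : (comulMap e he).lTensor (Corner e he) ∘ₗ
        TensorProduct.map (proj e he) (proj e he) =
        TensorProduct.map (proj e he) (TensorProduct.map (proj e he) (proj e he)) ∘ₗ
          (comul : C →ₗ[k] C ⊗[k] C).lTensor C := by
      rw [LinearMap.lTensor_comp_map, comulMap_comp_proj, LinearMap.map_comp_lTensor]
    rw [← LinearMap.comp_assoc _ _ (LinearMap.rTensor _ _), h1,
      ← LinearMap.comp_assoc _ _ (LinearMap.lTensor _ _), h2, LinearMap.comp_assoc,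
      LinearMap.comp_assoc, ← Coalgebra.coassoc]
    simp only [← LinearMap.comp_assoc]
    congr 2
    ext; simp
  rTensor_counit_comp_comul := by
    rw [← LinearMap.cancel_right (proj_surjective e he)]
    simp only [LinearMap.comp_assoc, comulMap_comp_proj]
    ext c
    have h : (TensorProduct.mk k k (Corner e he)) 1 (proj e he c) =
        (1 : k) ⊗ₜ[k] proj e he (actR e c) := by rw [proj_actR]; rfl
    simp only [LinearMap.comp_apply]
    rw [h, actR]
    simp only [LinearMap.comp_apply, LinearEquiv.coe_coe]
    induction (comul c : C ⊗[k] C) with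
    | zero => simp
    | tmul x y => simp [counit_proj, TensorProduct.smul_tmul']
    | add x y hx hy => simp only [map_add, TensorProduct.tmul_add, hx, hy]
  lTensor_counit_comp_comul := by
    rw [← LinearMap.cancel_right (proj_surjective e he)]
    simp only [LinearMap.comp_assoc, comulMap_comp_proj]
    ext c
    have h : (TensorProduct.mk k (Corner e he) k).flip 1 (proj e he c) =
        proj e he (actL e c) ⊗ₜ[k] (1 : k) := by rw [proj_actL]; rfl
    simp only [LinearMap.comp_apply]
    rw [h, actL]
    simp only [LinearMap.comp_apply, LinearEquiv.coe_coe]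
    induction (comul c : C ⊗[k] C) with
    | zero => simp
    | tmul x y => simp [counit_proj, TensorProduct.smul_tmul]
    | add x y hx hy => simp only [map_add, TensorProduct.add_tmul, hx, hy]

end Corner

end Corner

/-- `(e i)_{i ∈ I}` is a basic set of idempotents for `C`, relative to a family `(S i)_{i ∈ I}` of
right comodules: the `e i` are orthogonal idempotents of `C^*`, and `C e_i` is an injective hull
of `S i` for every `i`. -/
structure IsBasicSetOfIdempotents {k : Type u} {C : Type v} [Field k] [AddCommGroup C]
    [Module k C] [Coalgebra k C] {I : Type w} {S : I → Type v} [∀ i, AddCommGroup (S i)]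
    [∀ i, Module k (S i)] (σ : ∀ i, RightComodule k C (S i)) (e : I → DualAlg k C) : Prop where
  orthogonal : OrthogonalIdempotents e
  hull : ∀ i, (σ i).IsInjectiveHull (leftIdealComodule (e i))

/-! ### Coalgebras -/

section Coalgebras

variable (k : Type u) (C : Type v) [Field k] [AddCommGroup C] [Module k C] [Coalgebra k C]

/-- `C` is strictly quasi-finite (as a right comodule over itself). -/
def IsStrictlyQuasiFiniteCoalgebra : Prop := (RightComodule.regular k C).IsStrictlyQuasiFinite

/-- `C` is artinian (as a right comodule over itself). -/
def IsArtinianCoalgebra : Prop := (RightComodule.regular k C).IsArtinian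

/-- `C` is colocal: its dual algebra is a local algebra. -/
def IsColocalCoalgebra : Prop := IsLocalRing (DualAlg k C)

open scoped Classical in
/-- `C` is isomorphic, as a coalgebra, to a direct sum of co-commutative artinian colocal
coalgebras. (`Π₀ j, D j` is the direct sum of the `D j`; as colocal coalgebras are nonzero,
there is no loss in taking the index set in the universe of `C`.) -/
def IsDirectSumOfArtinianColocal : Prop :=
  ∃ (J : Type v) (D : J → Type v) (_ : ∀ j, AddCommGroup (D j)) (_ : ∀ j, Module k (D j))
    (_ : ∀ j, Coalgebra k (D j)),
    (∀ j, IsCocomm k (D j)) ∧ (∀ j, IsArtinianCoalgebra k (D j)) ∧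
      (∀ j, IsColocalCoalgebra k (D j)) ∧ Nonempty (C ≃ₗc[k] (Π₀ j, D j))

end Coalgebras

/-! Write `A = C^*`. Contracting the structure map with functionals makes every right comodule an
`A`-module whose submodules and `A`-linear maps are exactly the subcomodules and comodule morphisms
(`isSubcomodule_iff`, `mem_hom_iff`), and every element generates a finite-dimensional subcomodule.
Since `C` is co-commutative, `A` is commutative: each functional acts on `C` by comodule
endomorphisms, `Ce = eC = eCe`, and `eCe` is a subcoalgebra. So `e_iCe_i` is artinian iff the
subcomodules of `C` inside `e_iC` satisfy the descending chain condition
(`Corner.isArtinianCoalgebra_iff`). As a hull of `S_i`, `e_iC` has a copy of `S_i` as smallest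
nonzero subcomodule; `e_i` is the identity on `S_i` and zero on every other `S_j`, whence `C` is the
direct sum of the `e_iC`.

(i) ⇒ (ii): for a descending chain in `e_iC` with intersection `X`, only `S_i` can occur as a simple
subcomodule of the images in `C/X`. The sum of all copies of `S_i` in `C/X` is finite-dimensional,
so the traces of the chain on it stabilise, necessarily at zero. (ii) ⇒ (i): by minimality, finitely
many functionals on `C/X` detect every morphism `S_i → C/X` (`finiteDimensional_hom_quotient`). (ii)
⇒ (iii): the summands `e_iC` are colocal because they have a smallest nonzero subcomodule. (iii) ⇒
(ii): some projection onto a summand is nonzero on the smallest subcomodule of `e_iC`, hence embeds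
`e_iC` in an artinian coalgebra. (ii) ⇔ (iv): ideals of the dual algebra are compared with
subcomodules through orthogonals (`isNoetherianRing_dualAlg_iff`). -/

/-! ### Testing tensors by functionals. -/

section Contraction

variable {k : Type u} {C : Type v} {M : Type*} {N : Type*} [Field k] [AddCommGroup C] [Module k C]
  [AddCommGroup M] [Module k M] [AddCommGroup N] [Module k N]

/-- Contraction of the right tensor factor with a functional. -/
noncomputable def rightContraction (f : C →ₗ[k] k) : M ⊗[k] C →ₗ[k] M :=
  (TensorProduct.rid k M).toLinearMap ∘ₗ f.lTensor M

@[simp]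
lemma rightContraction_tmul (f : C →ₗ[k] k) (m : M) (c : C) :
    rightContraction f (m ⊗ₜ[k] c) = f c • m := by
  simp [rightContraction]

lemma rightContraction_rTensor (f : C →ₗ[k] k) (g : M →ₗ[k] N) (t : M ⊗[k] C) :
    rightContraction f (g.rTensor C t) = g (rightContraction f t) := by
  induction t with
  | zero => simp
  | tmul m c => simp
  | add x y hx hy => simp only [map_add, hx, hy]

/-- A basis of `C` turns tensors into finitely supported families in `M`, whose entries are the
contractions with the coordinate functionals. -/
lemma rightContraction_ext {s t : M ⊗[k] C}
    (h : ∀ f : C →ₗ[k] k, rightContraction f s = rightContraction f t) : s = t := by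
  classical
  let b := Module.Basis.ofVectorSpace k C
  refine (TensorProduct.equivFinsuppOfBasisRight (M := M) b).injective (Finsupp.ext fun i => ?_)
  rw [TensorProduct.equivFinsuppOfBasisRight_apply, TensorProduct.equivFinsuppOfBasisRight_apply]
  exact h (b.coord i)

/-- Tensoring is right exact, so membership means vanishing in `(M / X) ⊗ C`, which contractions
detect. -/
lemma mem_range_rTensor_subtype_iff (X : Submodule k M) (t : M ⊗[k] C) :
    t ∈ LinearMap.range (X.subtype.rTensor C) ↔ ∀ f : C →ₗ[k] k, rightContraction f t ∈ X := by
  constructor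
  · rintro ⟨s, rfl⟩ f
    rw [rightContraction_rTensor]
    exact Subtype.property _
  · intro h
    refine (rTensor_exact C (LinearMap.exact_subtype_mkQ X) X.mkQ_surjective t).1
      (rightContraction_ext fun f => ?_)
    rw [rightContraction_rTensor, map_zero]
    exact (Submodule.Quotient.mk_eq_zero X).2 (h f)

lemma exists_finiteDimensional_rightContraction_mem (t : M ⊗[k] C) :
    ∃ X : Submodule k M, FiniteDimensional k X ∧ ∀ f : C →ₗ[k] k, rightContraction f t ∈ X := by
  induction t with
  | zero => exact ⟨⊥, inferInstance, by simp⟩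
  | tmul m c =>
    exact ⟨k ∙ m, inferInstance, fun f => by
      simpa using Submodule.smul_mem _ _ (Submodule.mem_span_singleton_self m)⟩
  | add x y hx hy =>
    obtain ⟨X, hX, hx⟩ := hx
    obtain ⟨Y, hY, hy⟩ := hy
    exact ⟨X ⊔ Y, inferInstance, fun f => by
      rw [map_add]
      exact add_mem (Submodule.mem_sup_left (hx f)) (Submodule.mem_sup_right (hy f))⟩

end Contraction

/-! ### Comodules as modules over the dual algebra. -/

namespace RightComodule

variable {k : Type u} {C : Type v} [Field k] [AddCommGroup C] [Module k C] [Coalgebra k C]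
variable {M N : Type w} [AddCommGroup M] [Module k M] [AddCommGroup N] [Module k N]

/-- The action `m ↦ f m = ∑ m₀ f(m₁)` of the dual algebra on a right comodule. -/
noncomputable def act (ρ : RightComodule k C M) : DualAlg k C →ₗ[k] M →ₗ[k] M where
  toFun f := rightContraction f.ofConv ∘ₗ ρ.coact
  map_add' f g := by
    ext m
    simp [rightContraction, LinearMap.lTensor_add]
  map_smul' a f := by
    ext m
    simp [rightContraction, LinearMap.lTensor_smul]

lemma act_apply (ρ : RightComodule k C M) (f : DualAlg k C) (m : M) :
    ρ.act f m = rightContraction f.ofConv (ρ.coact m) := rfl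

lemma act_one (ρ : RightComodule k C M) (m : M) : ρ.act 1 m = m := by
  have h := LinearMap.congr_fun ρ.counit_coact m
  simp only [LinearMap.comp_apply, LinearMap.flip_apply, TensorProduct.mk_apply] at h
  change TensorProduct.rid k M ((counit : C →ₗ[k] k).lTensor M (ρ.coact m)) = m
  rw [h]
  simp

lemma act_mul (ρ : RightComodule k C M) (f g : DualAlg k C) (m : M) :
    ρ.act (f * g) m = ρ.act f (ρ.act g m) := by
  have h := LinearMap.congr_fun ρ.coassoc m
  simp only [LinearMap.comp_apply, LinearEquiv.coe_coe] at h
  have h1 : ∀ t : M ⊗[k] C, rightContraction (f * g).ofConv t =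
      rightContraction (LinearMap.mul' k k ∘ₗ TensorProduct.map f.ofConv g.ofConv)
        ((comul : C →ₗ[k] C ⊗[k] C).lTensor M t) := by
    intro t
    induction t with
    | zero => simp
    | tmul m c => simp
    | add x y hx hy => simp only [map_add, hx, hy]
  have h2 : ∀ t : (M ⊗[k] C) ⊗[k] C,
      rightContraction (LinearMap.mul' k k ∘ₗ TensorProduct.map f.ofConv g.ofConv)
        (TensorProduct.assoc k M C C t) = rightContraction f.ofConv (rightContraction g.ofConv t) := by
    intro t
    induction t with
    | zero => simp
    | tmul s c =>
      induction s with
      | zero => simp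
      | tmul m d => simp [mul_smul, smul_comm (f.ofConv d)]
      | add x y hx hy => simp only [TensorProduct.add_tmul, map_add, hx, hy]
    | add x y hx hy => simp only [map_add, hx, hy]
  rw [act_apply, h1, ← h, h2, rightContraction_rTensor]
  rfl

lemma isSubcomodule_iff (ρ : RightComodule k C M) (X : Submodule k M) :
    ρ.IsSubcomodule X ↔ ∀ f, ∀ x ∈ X, ρ.act f x ∈ X :=
  ⟨fun h f x hx => (mem_range_rTensor_subtype_iff X _).1 (h x hx) f.ofConv,
    fun h x hx => (mem_range_rTensor_subtype_iff X _).2 fun f => h (.toConv f) x hx⟩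

lemma mem_hom_iff (ρ : RightComodule k C M) (σ : RightComodule k C N) (h : M →ₗ[k] N) :
    h ∈ ρ.hom σ ↔ ∀ f x, h (ρ.act f x) = σ.act f (h x) := by
  constructor
  · intro hh f x
    have := LinearMap.congr_fun (show σ.coact ∘ₗ h = h.rTensor C ∘ₗ ρ.coact from hh) x
    simp only [LinearMap.comp_apply] at this
    rw [act_apply, act_apply, this, rightContraction_rTensor]
  · intro hh
    refine LinearMap.ext fun x => rightContraction_ext fun f => ?_
    simp only [LinearMap.comp_apply, rightContraction_rTensor]
    exact (hh (.toConv f) x).symm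

lemma act_restrict (ρ : RightComodule k C M) (X : Submodule k M) (hX : ρ.IsSubcomodule X)
    (f : DualAlg k C) (x : X) : (((ρ.restrict X hX).act f x : X) : M) = ρ.act f x := by
  have h : X.subtype ∈ (ρ.restrict X hX).hom ρ := (ρ.rTensor_subtype_restrictCoact X hX).symm
  exact (mem_hom_iff _ _ _).1 h f x

lemma act_quotient (ρ : RightComodule k C M) (X : Submodule k M) (hX : ρ.IsSubcomodule X)
    (f : DualAlg k C) (x : M) :
    (ρ.quotient X hX).act f (X.mkQ x) = X.mkQ (ρ.act f x) := by
  have h : X.mkQ ∈ ρ.hom (ρ.quotient X hX) := Submodule.liftQ_mkQ _ _ _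
  exact ((mem_hom_iff _ _ _).1 h f x).symm

/-- The subcomodule generated by an element. -/
noncomputable def orbit (ρ : RightComodule k C M) (x : M) : Submodule k M :=
  LinearMap.range (ρ.act.flip x)

lemma mem_orbit_self (ρ : RightComodule k C M) (x : M) : x ∈ ρ.orbit x :=
  ⟨1, ρ.act_one x⟩

lemma orbit_isSubcomodule (ρ : RightComodule k C M) (x : M) : ρ.IsSubcomodule (ρ.orbit x) := by
  rw [isSubcomodule_iff]
  rintro f _ ⟨g, rfl⟩
  exact ⟨f * g, ρ.act_mul f g x⟩

lemma orbit_le (ρ : RightComodule k C M) {x : M} {X : Submodule k M} (hX : ρ.IsSubcomodule X)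
    (hx : x ∈ X) : ρ.orbit x ≤ X := by
  rintro _ ⟨f, rfl⟩
  exact (ρ.isSubcomodule_iff X).1 hX f x hx

/-- Local finiteness: the structure map sends `x` to a finite sum of pure tensors, and the orbit
lies in the span of their left factors. -/
instance finiteDimensional_orbit (ρ : RightComodule k C M) (x : M) :
    FiniteDimensional k (ρ.orbit x) := by
  obtain ⟨X, hX, h⟩ := exists_finiteDimensional_rightContraction_mem (ρ.coact x)
  refine Submodule.finiteDimensional_of_le (S₂ := X) ?_
  rintro _ ⟨f, rfl⟩
  exact h f.ofConv

lemma isSubcomodule_range {ρ : RightComodule k C M} {σ : RightComodule k C N} {h : M →ₗ[k] N}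
    (hh : h ∈ ρ.hom σ) : σ.IsSubcomodule (LinearMap.range h) := by
  rw [isSubcomodule_iff]
  rintro f _ ⟨x, rfl⟩
  exact ⟨ρ.act f x, (mem_hom_iff _ _ _).1 hh f x⟩

lemma isSubcomodule_ker {ρ : RightComodule k C M} {σ : RightComodule k C N} {h : M →ₗ[k] N}
    (hh : h ∈ ρ.hom σ) : ρ.IsSubcomodule (LinearMap.ker h) := by
  rw [isSubcomodule_iff]
  intro f x hx
  rw [LinearMap.mem_ker] at hx ⊢
  rw [(mem_hom_iff _ _ _).1 hh, hx, map_zero]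

lemma isSubcomodule_map {ρ : RightComodule k C M} {σ : RightComodule k C N} {h : M →ₗ[k] N}
    (hh : h ∈ ρ.hom σ) {X : Submodule k M} (hX : ρ.IsSubcomodule X) :
    σ.IsSubcomodule (X.map h) := by
  rw [isSubcomodule_iff] at hX ⊢
  rintro f _ ⟨x, hx, rfl⟩
  exact ⟨ρ.act f x, hX f x hx, (mem_hom_iff _ _ _).1 hh f x⟩

lemma isSubcomodule_inf (ρ : RightComodule k C M) {X Y : Submodule k M} (hX : ρ.IsSubcomodule X)
    (hY : ρ.IsSubcomodule Y) : ρ.IsSubcomodule (X ⊓ Y) := by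
  rw [isSubcomodule_iff] at hX hY ⊢
  exact fun f x hx => ⟨hX f x hx.1, hY f x hx.2⟩

lemma mkQ_mem_hom (ρ : RightComodule k C M) (X : Submodule k M) (hX : ρ.IsSubcomodule X) :
    X.mkQ ∈ ρ.hom (ρ.quotient X hX) :=
  (mem_hom_iff _ _ _).2 fun f x => (ρ.act_quotient X hX f x).symm

lemma subtype_mem_hom (ρ : RightComodule k C M) (X : Submodule k M) (hX : ρ.IsSubcomodule X) :
    X.subtype ∈ (ρ.restrict X hX).hom ρ :=
  (mem_hom_iff _ _ _).2 fun f x => ρ.act_restrict X hX f x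

lemma IsSimple.finiteDimensional {ρ : RightComodule k C M} (h : ρ.IsSimple) :
    FiniteDimensional k M := by
  obtain ⟨_, h⟩ := h
  obtain ⟨x, hx⟩ := exists_ne (0 : M)
  have : ρ.orbit x = ⊤ := (h _ (ρ.orbit_isSubcomodule x)).resolve_left fun hb =>
    hx ((Submodule.mem_bot k).1 (hb ▸ ρ.mem_orbit_self x))
  have h2 := ρ.finiteDimensional_orbit x
  rw [this] at h2
  exact Module.Finite.equiv (Submodule.topEquiv (R := k) (M := M))

/-- Every nonzero subcomodule contains a simple subcomodule. -/
lemma exists_isSimple_le (ρ : RightComodule k C M) {X : Submodule k M} (hX : ρ.IsSubcomodule X)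
    (h0 : X ≠ ⊥) : ∃ (T : Submodule k M) (hT : ρ.IsSubcomodule T),
      T ≤ X ∧ (ρ.restrict T hT).IsSimple := by
  obtain ⟨x, hx, hx0⟩ := X.exists_mem_ne_zero_of_ne_bot h0
  let P : Set (Submodule k M) :=
    {Y | ρ.IsSubcomodule Y ∧ Y ≤ X ∧ Y ≠ ⊥ ∧ FiniteDimensional k Y}
  have hP : ρ.orbit x ∈ P := ⟨ρ.orbit_isSubcomodule x, ρ.orbit_le hX hx,
    fun hb => hx0 ((Submodule.mem_bot k).1 (hb ▸ ρ.mem_orbit_self x)), inferInstance⟩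
  -- The orbit of a nonzero element is finite-dimensional, so a nonzero subcomodule of least
  -- dimension exists; it is simple.
  obtain ⟨T, hTP, hmin⟩ := exists_minimalFor_of_wellFoundedLT (· ∈ P)
    (fun Y => Module.finrank k Y) ⟨_, hP⟩
  obtain ⟨hT, hTX, hT0, hTf⟩ := hTP
  refine ⟨T, hT, hTX, (Submodule.nontrivial_iff_ne_bot).2 hT0, fun Y hY => ?_⟩
  refine or_iff_not_imp_left.2 fun hY0 => ?_
  have hY' : ρ.IsSubcomodule (Y.map T.subtype) := isSubcomodule_map (ρ.subtype_mem_hom T hT) hY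
  have hle : Y.map T.subtype ≤ T := T.map_subtype_le Y
  have hm := hmin (j := Y.map T.subtype) ⟨hY', hle.trans hTX, fun hb =>
    hY0 ((Submodule.map_injective_of_injective T.injective_subtype) (hb.trans (Submodule.map_bot _).symm)),
    Submodule.finiteDimensional_of_le hle⟩ (Submodule.finrank_mono hle)
  have heq := Submodule.eq_of_le_of_finrank_le hle hm
  refine eq_top_iff.2 fun y _ => ?_
  obtain ⟨z, hz, hzy⟩ := (heq.ge y.2 : (y : M) ∈ Y.map T.subtype)
  rwa [← Subtype.ext hzy]

end RightComodule

/-! ### Ideals of the dual algebra and subcomodules of `C`. -/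

section DualAlgebra

variable {k : Type u} {C : Type v} [Field k] [AddCommGroup C] [Module k C] [Coalgebra k C]

open RightComodule

lemma act_regular (f : DualAlg k C) : (regular k C).act f = actL f := rfl

lemma apply_act_regular (f g : DualAlg k C) (c : C) :
    f.ofConv ((regular k C).act g c) = (f * g).ofConv c := by
  change f.ofConv (actL g c) = LinearMap.mul' k k (TensorProduct.map f.ofConv g.ofConv (comul c))
  rw [actL]
  simp only [LinearMap.comp_apply, LinearEquiv.coe_coe]
  induction (comul c : C ⊗[k] C) with
  | zero => simp
  | tmul x y => simp [mul_comm]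
  | add x y hx hy => simp only [map_add, hx, hy]

/-- A functional vanishing on the common kernel of the actions of `f₁, …, fₙ` lies in the left
ideal generated by `f₁, …, fₙ`. -/
lemma mem_span_of_forall_act_eq_zero (F : Finset (DualAlg k C)) (g : DualAlg k C)
    (h : ∀ c, (∀ f ∈ F, (regular k C).act f c = 0) → g.ofConv c = 0) :
    g ∈ Ideal.span (F : Set (DualAlg k C)) := by
  classical
  let Φ : C →ₗ[k] (F → C) := LinearMap.pi fun f => (regular k C).act f
  have hg : g.ofConv ∈ (LinearMap.ker Φ).dualAnnihilator := by
    rw [Submodule.mem_dualAnnihilator]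
    intro c hc
    exact h c fun f hf => congrFun (LinearMap.mem_ker.1 hc) ⟨f, hf⟩
  -- Vanishing on the kernel of `Φ` makes `g` factor as `φ ∘ Φ`; the components of `φ` on the copies
  -- of `C` are the coefficients of the combination.
  rw [← LinearMap.range_dualMap_eq_dualAnnihilator_ker] at hg
  obtain ⟨φ, hφ⟩ := hg
  have hsum : g = ∑ f : F, WithConv.toConv (φ ∘ₗ LinearMap.single k (fun _ : F => C) f) *
      (f : DualAlg k C) := by
    refine WithConv.ext (LinearMap.ext fun c => ?_)
    have h1 : (∑ f : F, WithConv.toConv (φ ∘ₗ LinearMap.single k (fun _ : F => C) f) *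
        (f : DualAlg k C)).ofConv c = ∑ f : F,
        (WithConv.toConv (φ ∘ₗ LinearMap.single k (fun _ : F => C) f) *
        (f : DualAlg k C)).ofConv c := by
      have := map_sum (WithConv.linearEquiv k (C →ₗ[k] k)) (fun f : F =>
        WithConv.toConv (φ ∘ₗ LinearMap.single k (fun _ : F => C) f) *
        (f : DualAlg k C)) Finset.univ
      have := LinearMap.congr_fun this c
      rw [LinearMap.sum_apply] at this
      exact this
    rw [h1, ← hφ]
    simp only [← apply_act_regular]
    change φ (Φ c) = _
    conv_lhs => rw [← Finset.univ_sum_single (Φ c), map_sum]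
    rfl
  rw [hsum]
  exact Ideal.sum_mem _ fun f _ => Ideal.mul_mem_left _ _ (Ideal.subset_span f.2)

variable [IsCocomm k C]

lemma actR_eq_actL (f : DualAlg k C) : actR f = actL f := by
  ext c
  rw [actR, actL]
  simp only [LinearMap.comp_apply, LinearEquiv.coe_coe]
  conv_lhs => rw [← Coalgebra.comm_comul k c]
  induction (comul c : C ⊗[k] C) with
  | zero => simp
  | tmul x y => simp
  | add x y hx hy => simp only [map_add, hx, hy]

lemma RightComodule.act_comm {M : Type w} [AddCommGroup M] [Module k M]
    (ρ : RightComodule k C M) (f g : DualAlg k C) (m : M) :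
    ρ.act f (ρ.act g m) = ρ.act g (ρ.act f m) := by
  rw [← act_mul, ← act_mul, mul_comm]

lemma RightComodule.act_mem_hom {M : Type w} [AddCommGroup M] [Module k M]
    (ρ : RightComodule k C M) (f : DualAlg k C) : ρ.act f ∈ ρ.hom ρ :=
  (mem_hom_iff _ _ _).2 fun g x => ρ.act_comm f g x

lemma isNoetherianRing_dualAlg_of_isArtinianCoalgebra (h : IsArtinianCoalgebra k C) :
    IsNoetherianRing (DualAlg k C) := by
  classical
  rw [isNoetherianRing_iff_ideal_fg]
  intro I
  let X : Finset (DualAlg k C) → {X : Submodule k C // (regular k C).IsSubcomodule X} := fun F =>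
    ⟨⨅ f ∈ F, LinearMap.ker ((regular k C).act f), by
      rw [isSubcomodule_iff]
      intro g x hx
      simp only [Submodule.mem_iInf, LinearMap.mem_ker] at hx ⊢
      intro f hf
      rw [act_comm, hx f hf, map_zero]⟩
  have hwf : WellFoundedLT {X : Submodule k C // (regular k C).IsSubcomodule X} := h
  -- Take a finite `F ⊆ I` with minimal common kernel. Adjoining `g ∈ I` cannot shrink it, so `g`
  -- vanishes there and lies in the ideal spanned by `F`.
  obtain ⟨F, hF, hmin⟩ := exists_minimalFor_of_wellFoundedLT
    (fun F : Finset (DualAlg k C) => (F : Set (DualAlg k C)) ⊆ I) X ⟨∅, by simp⟩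
  refine ⟨F, le_antisymm (Ideal.span_le.2 hF) fun g hg => ?_⟩
  refine mem_span_of_forall_act_eq_zero F g fun c hc => ?_
  have hle : X (insert g F) ≤ X F := by
    exact biInf_mono (f := fun f => LinearMap.ker ((regular k C).act f)) fun f hf =>
      Finset.mem_insert_of_mem hf
  have hc' : c ∈ (X (insert g F)).1 := by
    refine hmin (j := insert g F) ?_ hle ?_
    · beta_reduce
      rw [Finset.coe_insert]
      exact Set.insert_subset hg hF
    · simpa [X, Submodule.mem_iInf] using hc
  simp only [X, Submodule.mem_iInf, LinearMap.mem_ker] at hc'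
  have := apply_act_regular 1 g c
  rw [hc' g (Finset.mem_insert_self _ _), one_mul, map_zero] at this
  exact this.symm

/-- The orthogonal of a subcomodule is an ideal, and taking orthogonals reverses strict inclusions
because functionals separate points from subspaces. -/
lemma isArtinianCoalgebra_of_isNoetherianRing_dualAlg [IsNoetherianRing (DualAlg k C)] :
    IsArtinianCoalgebra k C := by
  let ann : {X : Submodule k C // (regular k C).IsSubcomodule X} → Ideal (DualAlg k C) :=
    fun X =>
    { carrier := {f | ∀ x ∈ X.1, f.ofConv x = 0}
      add_mem' := fun {f g} hf hg x hx => by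
        simp only [WithConv.ofConv_add, LinearMap.add_apply, hf x hx, hg x hx, add_zero]
      zero_mem' := fun x _ => by simp
      smul_mem' := fun f g hg x hx => by
        rw [smul_eq_mul, mul_comm, ← apply_act_regular]
        exact hg _ (((regular k C).isSubcomodule_iff X.1).1 X.2 f x hx) }
  have hanti : StrictAnti ann := by
    intro X Y hXY
    refine lt_of_le_not_ge (fun f hf x hx => hf x (hXY.le hx)) fun hle => hXY.not_ge ?_
    intro y hy
    by_contra hyX
    obtain ⟨f, hf, hfX⟩ := Submodule.exists_le_ker_of_notMem hyX
    exact hf (hle (show WithConv.toConv f ∈ ann X from fun x hx => hfX hx) y hy)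
  exact hanti.wellFoundedLT

lemma isNoetherianRing_dualAlg_iff :
    IsNoetherianRing (DualAlg k C) ↔ IsArtinianCoalgebra k C :=
  ⟨fun _ => isArtinianCoalgebra_of_isNoetherianRing_dualAlg,
    isNoetherianRing_dualAlg_of_isArtinianCoalgebra⟩

/-- With zero kernel, every functional, in particular the unit, lies in the ideal generated by `f`.
-/
lemma isUnit_of_ker_act_eq_bot {f : DualAlg k C}
    (h : LinearMap.ker ((regular k C).act f) = ⊥) : IsUnit f := by
  have := mem_span_of_forall_act_eq_zero {f} 1 fun c hc => by
    have hc0 : c ∈ LinearMap.ker ((regular k C).act f) := hc f (Finset.mem_singleton_self f)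
    rw [h, Submodule.mem_bot] at hc0
    rw [hc0, map_zero]
  rw [Finset.coe_singleton, Ideal.mem_span_singleton] at this
  exact isUnit_of_dvd_one this

/-- A coalgebra with a smallest nonzero subcomodule is colocal. -/
lemma isColocalCoalgebra_of_forall_mem {x : C} (hx : x ≠ 0)
    (h : ∀ X : Submodule k C, (regular k C).IsSubcomodule X → X ≠ ⊥ → x ∈ X) :
    IsColocalCoalgebra k C := by
  -- A nonunit has nonzero kernel, which is a subcomodule and so contains `x`. Hence the nonunits
  -- form the annihilator of `x`, closed under addition.
  have key : ∀ f : DualAlg k C, f ∈ nonunits _ ↔ (regular k C).act f x = 0 := by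
    intro f
    rw [mem_nonunits_iff]
    constructor
    · intro hf
      by_contra h0
      exact hf (isUnit_of_ker_act_eq_bot (by_contra fun hk =>
        h0 (h _ (isSubcomodule_ker ((regular k C).act_mem_hom f)) hk)))
    · rintro h0 ⟨u, rfl⟩
      apply hx
      rw [← (regular k C).act_one x, ← u.inv_mul, act_mul, h0, map_zero]
  have : Nontrivial (DualAlg k C) := by
    refine ⟨0, 1, fun h01 => hx ?_⟩
    rw [← (regular k C).act_one x, ← h01, map_zero, LinearMap.zero_apply]
  refine IsLocalRing.of_nonunits_add fun f g hf hg => ?_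
  rw [key] at hf hg ⊢
  rw [map_add, LinearMap.add_apply, hf, hg, add_zero]

end DualAlgebra

/-! ### The chain condition along injective maps. -/

section Transport

variable {k : Type u} {C D : Type v} [Field k] [AddCommGroup C] [Module k C] [Coalgebra k C]
  [AddCommGroup D] [Module k D] [Coalgebra k D]

open RightComodule

/-- The descending chain condition for the subcomodules of `C` contained in a subspace `Y`. -/
def IsArtinianBelow (Y : Submodule k C) : Prop :=
  WellFoundedLT {X : Submodule k C // (regular k C).IsSubcomodule X ∧ X ≤ Y}

lemma IsArtinianBelow.of_injOn {Y Z : Submodule k C} (hZ : IsArtinianBelow Z) {p : C →ₗ[k] C}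
    (hp : p ∈ (regular k C).hom (regular k C)) (hinj : Set.InjOn p Y) (hmap : Y.map p ≤ Z) :
    IsArtinianBelow Y := by
  have hwf : WellFoundedLT {X : Submodule k C // (regular k C).IsSubcomodule X ∧ X ≤ Z} := hZ
  let F : {X : Submodule k C // (regular k C).IsSubcomodule X ∧ X ≤ Y} →
      {X : Submodule k C // (regular k C).IsSubcomodule X ∧ X ≤ Z} := fun X =>
    ⟨X.1.map p, isSubcomodule_map hp X.2.1, (Submodule.map_mono X.2.2).trans hmap⟩
  refine StrictMono.wellFoundedLT (f := F) fun X X' hlt =>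
    lt_of_le_not_ge (Submodule.map_mono hlt.le) fun hle => hlt.not_ge fun x hx => ?_
  obtain ⟨y, hy, hyx⟩ := hle (Submodule.mem_map_of_mem hx)
  rwa [← hinj (X.2.2 hy) (X'.2.2 hx) hyx]

lemma coalgHom_act (ψ : D →ₗc[k] C) (f : DualAlg k C) (d : D) :
    ψ ((regular k D).act (.toConv (f.ofConv ∘ₗ ψ.toLinearMap)) d) = (regular k C).act f (ψ d) := by
  rw [act_apply, act_apply]
  change ψ (rightContraction _ (comul d)) = rightContraction _ (comul (ψ d))
  rw [← CoalgHomClass.map_comp_comul_apply]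
  induction (comul d : D ⊗[k] D) with
  | zero => simp
  | tmul x y => simp
  | add x y hx hy => simp only [map_add, hx, hy]

lemma isSubcomodule_map_coalgHom_iff {ψ : D →ₗc[k] C} (hψ : Function.Injective ψ)
    (X : Submodule k D) : (regular k C).IsSubcomodule (X.map ψ.toLinearMap) ↔
      (regular k D).IsSubcomodule X := by
  rw [isSubcomodule_iff, isSubcomodule_iff]
  constructor
  · intro h g x hx
    -- A linear retraction of `ψ` extends each functional on `D` to one on `C`, so both dual
    -- algebras have the same stable subspaces in `D`.
    obtain ⟨r, hr⟩ := ψ.toLinearMap.exists_leftInverse_of_injective (LinearMap.ker_eq_bot.2 hψ)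
    have hg : g = .toConv ((g.ofConv ∘ₗ r) ∘ₗ ψ.toLinearMap) := by
      rw [LinearMap.comp_assoc, hr]
      rfl
    obtain ⟨y, hy, hyx⟩ := h (.toConv (g.ofConv ∘ₗ r)) (ψ x) (Submodule.mem_map_of_mem hx)
    have := coalgHom_act ψ (.toConv (g.ofConv ∘ₗ r)) x
    rw [hg]
    rwa [← hψ (hyx.trans this.symm)]
  · rintro h f _ ⟨x, hx, rfl⟩
    exact ⟨_, h _ x hx, coalgHom_act ψ f x⟩

lemma isArtinianCoalgebra_iff_isArtinianBelow_range {ψ : D →ₗc[k] C}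
    (hψ : Function.Injective ψ) :
    IsArtinianCoalgebra k D ↔ IsArtinianBelow (LinearMap.range ψ.toLinearMap) := by
  constructor
  · intro h
    have hwf : WellFoundedLT {X : Submodule k D // (regular k D).IsSubcomodule X} := h
    let F : {X : Submodule k C // (regular k C).IsSubcomodule X ∧
        X ≤ LinearMap.range ψ.toLinearMap} →
        {X : Submodule k D // (regular k D).IsSubcomodule X} := fun X =>
      ⟨X.1.comap ψ.toLinearMap, by
        rw [← isSubcomodule_map_coalgHom_iff hψ, Submodule.map_comap_eq_of_le X.2.2]
        exact X.2.1⟩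
    refine StrictMono.wellFoundedLT (f := F) fun X X' hlt =>
      lt_of_le_not_ge (Submodule.comap_mono hlt.le) fun hle => hlt.not_ge fun x hx => ?_
    obtain ⟨d, rfl⟩ := X'.2.2 hx
    exact hle hx
  · intro h
    have hwf : WellFoundedLT {X : Submodule k C // (regular k C).IsSubcomodule X ∧
        X ≤ LinearMap.range ψ.toLinearMap} := h
    let F : {X : Submodule k D // (regular k D).IsSubcomodule X} →
        {X : Submodule k C // (regular k C).IsSubcomodule X ∧
        X ≤ LinearMap.range ψ.toLinearMap} := fun X =>
      ⟨X.1.map ψ.toLinearMap, (isSubcomodule_map_coalgHom_iff hψ _).2 X.2,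
        LinearMap.map_le_range⟩
    refine StrictMono.wellFoundedLT (f := F) fun X X' hlt =>
      lt_of_le_not_ge (Submodule.map_mono hlt.le) fun hle => hlt.not_ge ?_
    exact (Submodule.map_le_map_iff_of_injective (f := ψ.toLinearMap) hψ _ _).1 hle

end Transport

/-! ### The subcoalgebra `eCe` in the co-commutative case. -/

namespace Corner

open RightComodule

variable {k : Type u} {C : Type v} [Field k] [AddCommGroup C] [Module k C] [Coalgebra k C]
  [IsCocomm k C] (e : DualAlg k C) (he : IsIdempotentElem e)

lemma sandwich_eq {e : DualAlg k C} (he : IsIdempotentElem e) : sandwich e = (regular k C).act e := by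
  ext c
  rw [sandwich, actR_eq_actL, LinearMap.comp_apply]
  exact ((regular k C).act_mul e e c).symm.trans (by rw [he.eq])

lemma range_incl : LinearMap.range (incl e he) = LinearMap.range ((regular k C).act e) := by
  rw [← sandwich_eq he]
  exact Submodule.range_subtype _

/-- For a co-commutative coalgebra, `eCe` is a subcoalgebra of `C`. -/
noncomputable def inclHom : Corner e he →ₗc[k] C where
  toLinearMap := incl e he
  counit_comp := rfl
  map_comp_comul := by
    rw [← LinearMap.cancel_right (proj_surjective e he)]
    change TensorProduct.map (incl e he) (incl e he) ∘ₗ comulMap e he ∘ₗ proj e he = _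
    rw [comulMap_comp_proj, ← LinearMap.comp_assoc, ← TensorProduct.map_comp, incl_comp_proj,
      LinearMap.comp_assoc, incl_comp_proj]
    conv_rhs => rw [sandwich, ← LinearMap.comp_assoc, comul_comp_actR, LinearMap.comp_assoc,
      comul_comp_actL, ← LinearMap.comp_assoc, LinearMap.rTensor_comp_lTensor]
    have h : sandwich e = actL e := sandwich_eq he
    rw [h, actR_eq_actL]

lemma inclHom_toLinearMap : (inclHom e he).toLinearMap = incl e he := rfl

lemma inclHom_injective : Function.Injective (inclHom e he) := incl_injective e he

instance : IsCocomm k (Corner e he) where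
  comm_comp_comul := by
    rw [← LinearMap.cancel_right (proj_surjective e he)]
    change ((TensorProduct.comm k _ _).toLinearMap ∘ₗ comulMap e he) ∘ₗ proj e he =
      comulMap e he ∘ₗ proj e he
    have h : (TensorProduct.comm k _ _).toLinearMap ∘ₗ
        TensorProduct.map (proj e he) (proj e he) =
        TensorProduct.map (proj e he) (proj e he) ∘ₗ (TensorProduct.comm k C C).toLinearMap := by
      ext
      rfl
    rw [LinearMap.comp_assoc, comulMap_comp_proj, ← LinearMap.comp_assoc, h,
      LinearMap.comp_assoc, Coalgebra.comm_comp_comul]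

lemma isArtinianCoalgebra_iff : IsArtinianCoalgebra k (Corner e he) ↔
    IsArtinianBelow (LinearMap.range ((regular k C).act e)) := by
  rw [isArtinianCoalgebra_iff_isArtinianBelow_range (inclHom_injective e he),
    inclHom_toLinearMap, range_incl]

lemma isColocalCoalgebra {x : C} (hx : x ≠ 0) (h : ∀ X : Submodule k C,
    (regular k C).IsSubcomodule X → X ≤ LinearMap.range ((regular k C).act e) → X ≠ ⊥ → x ∈ X)
    (hxe : x ∈ LinearMap.range ((regular k C).act e)) :
    IsColocalCoalgebra k (Corner e he) := by
  rw [← range_incl e he] at hxe h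
  obtain ⟨y, rfl⟩ := hxe
  refine isColocalCoalgebra_of_forall_mem (x := y) (fun h0 => hx (by rw [h0, map_zero]))
    fun X hX hX0 => ?_
  obtain ⟨z, hz, hzy⟩ := h _ ((isSubcomodule_map_coalgHom_iff (inclHom_injective e he) X).2 hX)
    LinearMap.map_le_range fun hb => hX0
      (Submodule.map_injective_of_injective (f := incl e he) (incl_injective e he)
        (hb.trans (Submodule.map_bot _).symm))
  rwa [← incl_injective e he hzy]

end Corner

open RightComodule

/-! ### One idempotent: hulls and finiteness of morphism spaces. -/

section Idempotents

variable {k : Type u} {C : Type v} [Field k] [AddCommGroup C] [Module k C] [Coalgebra k C]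

lemma act_eq_self_of_mem_range {e : DualAlg k C} (he : IsIdempotentElem e) {c : C}
    (hc : c ∈ LinearMap.range ((regular k C).act e)) : (regular k C).act e c = c := by
  obtain ⟨d, rfl⟩ := hc
  rw [← act_mul, he.eq]

lemma act_eq_self_of_range_le {S : Type v} [AddCommGroup S] [Module k S]
    {σ : RightComodule k C S} {e : DualAlg k C} (he : IsIdempotentElem e) {i : S →ₗ[k] C}
    (hi : i ∈ σ.hom (regular k C)) (hinj : Function.Injective i)
    (hle : LinearMap.range i ≤ LinearMap.range ((regular k C).act e)) (s : S) :
    σ.act e s = s := by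
  apply hinj
  rw [(mem_hom_iff _ _ _).1 hi]
  exact act_eq_self_of_mem_range he (hle ⟨s, rfl⟩)

variable [IsCocomm k C]

/-- If `Ce` is an injective hull of a simple comodule `S`, then `S` embeds in `eC = Ce` as the
smallest nonzero subcomodule. -/
lemma exists_smallest_of_isInjectiveHull {S : Type v} [AddCommGroup S] [Module k S]
    {σ : RightComodule k C S} (hσ : σ.IsSimple) {e : DualAlg k C}
    (h : σ.IsInjectiveHull (leftIdealComodule e)) :
    ∃ i ∈ σ.hom (regular k C), Function.Injective i ∧
      LinearMap.range i ≤ LinearMap.range ((regular k C).act e) ∧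
      ∀ X : Submodule k C, (regular k C).IsSubcomodule X →
        X ≤ LinearMap.range ((regular k C).act e) → X ≠ ⊥ → LinearMap.range i ≤ X := by
  obtain ⟨-, f, hf, hinj, hess⟩ := h
  have hrange : LinearMap.range ((regular k C).act e) = leftIdealSpace e := by
    rw [act_regular, ← actR_eq_actL]
  rw [hrange]
  have hsub : (leftIdealSpace e).subtype ∈ (leftIdealComodule e).hom (regular k C) :=
    subtype_mem_hom (regular k C) _ (leftIdealSpace_isSubcomodule e)
  refine ⟨(leftIdealSpace e).subtype ∘ₗ f, ?_, Subtype.val_injective.comp hinj, ?_, ?_⟩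
  · rw [mem_hom_iff] at hf hsub ⊢
    intro g x
    rw [LinearMap.comp_apply, hf, LinearMap.comp_apply]
    exact hsub g (f x)
  · rintro _ ⟨x, rfl⟩
    exact (f x).2
  · intro X hX hXe hX0
    have hX' : (leftIdealComodule e).IsSubcomodule (X.comap (leftIdealSpace e).subtype) := by
      rw [isSubcomodule_iff] at hX ⊢
      intro g x hx
      rw [Submodule.mem_comap, (mem_hom_iff _ _ _).1 hsub]
      exact hX g _ hx
    have hY : σ.IsSubcomodule ((X.comap (leftIdealSpace e).subtype).comap f) := by
      rw [isSubcomodule_iff] at hX' ⊢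
      intro g x hx
      rw [Submodule.mem_comap, (mem_hom_iff _ _ _).1 hf]
      exact hX' g _ hx
    -- By simplicity the part of `S` lying in `X` is zero, against essentiality, or all of `S`.
    rcases hσ.2 _ hY with h0 | h1
    · refine absurd ?_ hX0
      have := hess _ hX' ?_
      · rw [← Submodule.map_comap_eq_of_le (f := (leftIdealSpace e).subtype) (p := X)
          (by rwa [Submodule.range_subtype]), this, Submodule.map_bot]
      · rw [eq_bot_iff]
        rintro _ ⟨hy, x, rfl⟩
        have hx : x ∈ (X.comap (leftIdealSpace e).subtype).comap f := hy
        rw [h0, Submodule.mem_bot] at hx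
        rw [hx, map_zero]
        exact zero_mem _
    · rintro _ ⟨x, rfl⟩
      exact (h1.ge (Submodule.mem_top (x := x)) :)

/-- If `eC` is artinian and `e` acts as the identity on the finite-dimensional comodule `S`, then
`Com_C(S, C / X)` is finite-dimensional. -/
lemma finiteDimensional_hom_quotient {S : Type v} [AddCommGroup S] [Module k S]
    [FiniteDimensional k S] {σ : RightComodule k C S} {e : DualAlg k C}
    (h : IsArtinianBelow (LinearMap.range ((regular k C).act e)))
    (hS : ∀ s, σ.act e s = s) (X : Submodule k C) (hX : (regular k C).IsSubcomodule X) :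
    FiniteDimensional k (σ.hom ((regular k C).quotient X hX)) := by
  classical
  have hwf : WellFoundedLT {Y : Submodule k C // (regular k C).IsSubcomodule Y ∧
    Y ≤ LinearMap.range ((regular k C).act e)} := h
  -- `K F` is the largest subcomodule of `C` whose image in `C / X` is killed by all `ξ ∈ F`. A set
  -- `F` minimising `eC ⊓ K F` already detects all morphisms from `S`.
  let K : Finset (Module.Dual k (C ⧸ X)) → Submodule k C := fun F =>
    ⨅ ξ ∈ F, ⨅ f, LinearMap.ker (ξ ∘ₗ X.mkQ ∘ₗ (regular k C).act f)
  have hK : ∀ F c, c ∈ K F ↔ ∀ ξ ∈ F, ∀ f, ξ (X.mkQ ((regular k C).act f c)) = 0 := by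
    intro F c
    simp only [K, Submodule.mem_iInf, LinearMap.mem_ker, LinearMap.comp_apply]
  let N : Finset (Module.Dual k (C ⧸ X)) → {Y : Submodule k C // (regular k C).IsSubcomodule Y ∧
      Y ≤ LinearMap.range ((regular k C).act e)} := fun F =>
    ⟨LinearMap.range ((regular k C).act e) ⊓ K F, by
      refine isSubcomodule_inf _ (isSubcomodule_range (act_mem_hom _ e)) ?_
      rw [isSubcomodule_iff]
      intro g x hx
      rw [hK] at hx ⊢
      intro ξ hξ f
      rw [← act_mul]
      exact hx ξ hξ _, inf_le_left⟩
  obtain ⟨F, -, hmin⟩ := exists_minimalFor_of_wellFoundedLT (fun _ => True) N ⟨∅, trivial⟩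
  let Φ : σ.hom ((regular k C).quotient X hX) →ₗ[k] (F → S →ₗ[k] k) :=
    LinearMap.pi fun ξ => (LinearMap.llcomp k S (C ⧸ X) k (ξ : Module.Dual k (C ⧸ X))) ∘ₗ
      (σ.hom ((regular k C).quotient X hX)).subtype
  suffices hker : ∀ a, Φ a = 0 → a = 0 from
    Module.Finite.of_injective Φ fun a b hab => sub_eq_zero.1 (hker _ (by
      exact (Φ.map_sub a b).trans (sub_eq_zero.2 hab)))
  rintro ⟨a, ha⟩ hΦ
  have ha0 : ∀ ξ ∈ F, ∀ s, ξ (a s) = 0 := fun ξ hξ s =>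
    LinearMap.congr_fun (congrFun hΦ ⟨ξ, hξ⟩) s
  rw [mem_hom_iff] at ha
  refine Subtype.ext (LinearMap.ext fun s => ?_)
  change a s = 0
  by_contra hs
  obtain ⟨ξ, hξ⟩ : ∃ ξ : Module.Dual k (C ⧸ X), ξ (a s) ≠ 0 := by
    by_contra! hall
    exact hs ((Module.forall_dual_apply_eq_zero_iff k (a s)).1 hall)
  obtain ⟨c, hc⟩ := X.mkQ_surjective (a s)
  -- As `e` fixes `a s`, applying `e` moves the lift into `eC` without changing its class.
  have hc' : X.mkQ ((regular k C).act e c) = a s := by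
    rw [← act_quotient _ X hX, hc, ← ha, hS]
  have hmem : (regular k C).act e c ∈ (N F).1 := by
    refine ⟨⟨c, rfl⟩, (hK _ _).2 fun ξ hξ f => ?_⟩
    rw [← act_quotient _ X hX, hc', ← ha]
    exact ha0 ξ hξ _
  have hle : N (insert ξ F) ≤ N F := fun c hc => ⟨hc.1,
    (hK _ _).2 fun ξ hξ => (hK _ _).1 hc.2 ξ (Finset.mem_insert_of_mem hξ)⟩
  have := (hK _ _).1 (hmin (j := insert ξ F) trivial hle hmem).2 ξ (Finset.mem_insert_self _ _) 1
  rw [act_one, hc'] at this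
  exact hξ this

end Idempotents

/-! ### Orthogonal idempotents and direct decompositions. -/

section Orthogonal

variable {k : Type u} {C : Type v} [Field k] [AddCommGroup C] [Module k C] [Coalgebra k C]
  {I : Type w} {e : I → DualAlg k C}

lemma act_eq_zero_of_ne (he : OrthogonalIdempotents e) {i j : I} (hij : i ≠ j) {c : C}
    (hc : c ∈ LinearMap.range ((regular k C).act (e j))) : (regular k C).act (e i) c = 0 := by
  obtain ⟨d, rfl⟩ := hc
  rw [← act_mul, he.ortho hij, map_zero, LinearMap.zero_apply]

lemma iSupIndep_range_act (he : OrthogonalIdempotents e) :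
    iSupIndep fun i => LinearMap.range ((regular k C).act (e i)) := by
  intro i
  rw [Submodule.disjoint_def]
  intro c hc hc'
  have hle : ⨆ j, ⨆ _ : j ≠ i, LinearMap.range ((regular k C).act (e j)) ≤
      LinearMap.ker ((regular k C).act (e i)) :=
    iSup₂_le fun j hj c hc => act_eq_zero_of_ne he hj.symm hc
  rw [← act_eq_self_of_mem_range (he.idem i) hc]
  exact hle hc'

/-- The nonzero `e i c` lie in independent subspaces, hence are linearly independent inside the
finite-dimensional orbit of `c`. -/
lemma finite_act_ne_zero (he : OrthogonalIdempotents e) (c : C) :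
    {i | (regular k C).act (e i) c ≠ 0}.Finite := by
  have hli : LinearIndependent k (fun i : {i | (regular k C).act (e i) c ≠ 0} =>
      (regular k C).act (e i) c) :=
    ((iSupIndep_range_act he).comp Subtype.val_injective).linearIndependent _
      (fun i => ⟨c, rfl⟩) fun i => i.2
  have hli' : LinearIndependent k (fun i : {i | (regular k C).act (e i) c ≠ 0} =>
      (⟨(regular k C).act (e i) c, ⟨e i, rfl⟩⟩ : (regular k C).orbit c)) :=
    LinearIndependent.of_comp ((regular k C).orbit c).subtype hli
  exact hli'.finite

variable [IsCocomm k C]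

open scoped Classical in
/-- A co-commutative coalgebra that is the sum of the `e j C`, for orthogonal idempotents `e j`,
is isomorphic to the direct sum of the coalgebras `e j C e j`. -/
lemma nonempty_coalgEquiv_dfinsupp_corner (he : OrthogonalIdempotents e)
    (htop : ⨆ i, LinearMap.range ((regular k C).act (e i)) = ⊤) :
    Nonempty (C ≃ₗc[k] (Π₀ i, Corner (e i) (he.idem i))) := by
  let Ψ : (Π₀ i, Corner (e i) (he.idem i)) →ₗ[k] C :=
    DFinsupp.lsum k fun i => Corner.incl (e i) (he.idem i)
  have hsingle : ∀ i x, Ψ (DFinsupp.single i x) = Corner.incl (e i) (he.idem i) x := fun i x =>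
    DFinsupp.lsum_single _ _ _ _
  have hmem : ∀ i x, Corner.incl (e i) (he.idem i) x ∈
      LinearMap.range ((regular k C).act (e i)) := fun i x =>
    Corner.range_incl (e i) (he.idem i) ▸ LinearMap.mem_range_self _ x
  -- Acting by `e i` reads off the `i`-th coordinate, which gives injectivity.
  have hact : ∀ i x, (regular k C).act (e i) (Ψ x) = Corner.incl (e i) (he.idem i) (x i) := by
    intro i x
    induction x using DFinsupp.induction with
    | h0 => simp
    | ha j b x _ _ hx =>
      rw [map_add, map_add, hx, hsingle, DFinsupp.add_apply, map_add]
      congr 1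
      rcases eq_or_ne i j with rfl | hij
      · rw [DFinsupp.single_eq_same, act_eq_self_of_mem_range (he.idem i) (hmem i b)]
      · rw [DFinsupp.single_eq_of_ne hij, map_zero, act_eq_zero_of_ne he hij (hmem j b)]
  have hinj : Function.Injective Ψ := by
    refine (injective_iff_map_eq_zero Ψ).2 fun x hx => DFinsupp.ext fun i => ?_
    apply Corner.incl_injective
    rw [← hact, hx, map_zero, DFinsupp.zero_apply, map_zero]
  have hsurj : Function.Surjective Ψ := by
    rw [← LinearMap.range_eq_top, eq_top_iff, ← htop]
    refine iSup_le fun i => ?_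
    rw [← Corner.range_incl (e i) (he.idem i)]
    rintro _ ⟨x, rfl⟩
    exact ⟨DFinsupp.single i x, hsingle i x⟩
  let Ψc : (Π₀ i, Corner (e i) (he.idem i)) →ₗc[k] C :=
    { Ψ with
      counit_comp := by
        refine DFinsupp.lhom_ext fun i x => ?_
        rw [LinearMap.comp_apply, DFinsupp.counit_single]
        exact congrArg counit (hsingle i x)
      map_comp_comul := by
        refine DFinsupp.lhom_ext fun i x => ?_
        rw [LinearMap.comp_apply, LinearMap.comp_apply, DFinsupp.comul_single]
        have h : Ψ ∘ₗ DFinsupp.lsingle i = (Corner.inclHom (e i) (he.idem i)).toLinearMap :=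
          LinearMap.ext (hsingle i)
        change _ = comul (Ψ (DFinsupp.single i x))
        rw [← LinearMap.comp_apply, ← TensorProduct.map_comp, h, hsingle]
        exact CoalgHomClass.map_comp_comul_apply (Corner.inclHom (e i) (he.idem i)) x }
  exact ⟨(CoalgEquiv.ofBijective (f := Ψc) ⟨hinj, hsurj⟩).symm⟩

end Orthogonal

/-! ### Projections of a direct sum of coalgebras. -/

section DirectSum

variable {k : Type u} {C : Type v} [Field k] [AddCommGroup C] [Module k C] [Coalgebra k C]
  {J : Type v} [DecidableEq J] {D : J → Type v} [∀ j, AddCommGroup (D j)] [∀ j, Module k (D j)]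
  [∀ j, Coalgebra k (D j)]

/-- The inclusion of a summand in a direct sum of coalgebras. -/
noncomputable def coalgHomSingle (j : J) : D j →ₗc[k] (Π₀ j, D j) where
  toLinearMap := DFinsupp.lsingle j
  counit_comp := DFinsupp.counit_comp_lsingle k J D j
  map_comp_comul := (DFinsupp.comul_comp_lsingle k J D j).symm

lemma single_comp_apply_mem_hom (j : J) :
    (DFinsupp.lsingle j ∘ₗ DFinsupp.lapply j : (Π₀ j, D j) →ₗ[k] (Π₀ j, D j)) ∈
      (regular k (Π₀ j, D j)).hom (regular k (Π₀ j, D j)) := by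
  change comul ∘ₗ _ = LinearMap.rTensor _ _ ∘ₗ comul
  refine DFinsupp.lhom_ext fun i x => ?_
  simp only [LinearMap.comp_apply, DFinsupp.comul_single, DFinsupp.lapply_apply,
    DFinsupp.lsingle_apply]
  rw [← LinearMap.comp_apply (LinearMap.rTensor _ _), LinearMap.rTensor_comp_map]
  rcases eq_or_ne i j with rfl | hij
  · rw [DFinsupp.single_eq_same, LinearMap.comp_assoc]
    have h : DFinsupp.lapply i ∘ₗ DFinsupp.lsingle i = (LinearMap.id : D i →ₗ[k] D i) := by
      ext y
      simp
    rw [h, LinearMap.comp_id]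
  · have h : DFinsupp.lapply j ∘ₗ DFinsupp.lsingle i = (0 : D i →ₗ[k] D j) := by
      ext y
      simp [DFinsupp.single_eq_of_ne hij.symm]
    rw [DFinsupp.single_eq_of_ne hij.symm, LinearMap.comp_assoc, h]
    simp

/-- If `C` is a direct sum of artinian coalgebras, and the subcomodule `Y` of `C` has a smallest
nonzero subcomodule, then `Y` is artinian. -/
lemma isArtinianBelow_of_coalgEquiv (φ : C ≃ₗc[k] (Π₀ j, D j))
    (hD : ∀ j, IsArtinianCoalgebra k (D j)) {Y : Submodule k C}
    (hY : (regular k C).IsSubcomodule Y) {x : C} (hx : x ≠ 0)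
    (h : ∀ X : Submodule k C, (regular k C).IsSubcomodule X → X ≤ Y → X ≠ ⊥ → x ∈ X) :
    IsArtinianBelow Y := by
  obtain ⟨j, hj⟩ : ∃ j, φ x j ≠ 0 := by
    by_contra! hall
    exact hx ((map_eq_zero_iff φ φ.injective).1 (DFinsupp.ext hall))
  let ψ : D j →ₗc[k] C := (φ.symm : (Π₀ j, D j) →ₗc[k] C).comp (coalgHomSingle j)
  have hψ : Function.Injective ψ := φ.symm.injective.comp DFinsupp.single_injective
  let q : (Π₀ j, D j) →ₗ[k] (Π₀ j, D j) := DFinsupp.lsingle j ∘ₗ DFinsupp.lapply j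
  let p : C →ₗ[k] C := φ.symm.toLinearEquiv.toLinearMap ∘ₗ q ∘ₗ φ.toLinearEquiv.toLinearMap
  have hp : p ∈ (regular k C).hom (regular k C) := by
    change comul ∘ₗ p = p.rTensor C ∘ₗ comul
    have hq : comul ∘ₗ q = q.rTensor _ ∘ₗ comul := single_comp_apply_mem_hom j
    have h1 : comul ∘ₗ φ.symm.toLinearEquiv.toLinearMap = TensorProduct.map
        φ.symm.toLinearEquiv.toLinearMap φ.symm.toLinearEquiv.toLinearMap ∘ₗ comul :=
      φ.symm.map_comp_comul.symm
    have h2 : comul ∘ₗ φ.toLinearEquiv.toLinearMap = TensorProduct.map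
        φ.toLinearEquiv.toLinearMap φ.toLinearEquiv.toLinearMap ∘ₗ comul :=
      φ.map_comp_comul.symm
    have h3 : φ.symm.toLinearEquiv.toLinearMap ∘ₗ φ.toLinearEquiv.toLinearMap = LinearMap.id :=
      LinearMap.ext fun c => φ.symm_apply_apply c
    rw [← LinearMap.comp_assoc, h1, LinearMap.comp_assoc, ← LinearMap.comp_assoc _ q, hq,
      LinearMap.comp_assoc, h2, ← LinearMap.comp_assoc, ← LinearMap.comp_assoc,
      LinearMap.map_comp_rTensor, ← TensorProduct.map_comp, h3]
    rfl
  refine IsArtinianBelow.of_injOn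
    ((isArtinianCoalgebra_iff_isArtinianBelow_range hψ).1 (hD j)) hp ?_ ?_
  -- A nonzero kernel on `Y` would contain `x`, whose `j`-th component is nonzero.
  · have hker : LinearMap.ker p ⊓ Y = ⊥ := by
      by_contra h0
      have := h _ (isSubcomodule_inf _ (isSubcomodule_ker hp) hY) inf_le_right h0
      have hpx : ψ (φ x j) = 0 := LinearMap.mem_ker.1 this.1
      exact hj ((map_eq_zero_iff ψ hψ).1 hpx)
    intro a ha b hb hab
    have : a - b ∈ LinearMap.ker p ⊓ Y :=
      ⟨LinearMap.mem_ker.2 (by rw [map_sub, hab, sub_self]), sub_mem ha hb⟩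
    rwa [hker, Submodule.mem_bot, sub_eq_zero] at this
  · rintro _ ⟨c, -, rfl⟩
    exact ⟨φ c j, rfl⟩

end DirectSum

/-! ### Basic sets of idempotents. -/

section BasicIdempotents

variable {k : Type u} {C : Type v} [Field k] [AddCommGroup C] [Module k C] [Coalgebra k C]
  {I : Type w} {S : I → Type v} [∀ i, AddCommGroup (S i)] [∀ i, Module k (S i)]
  {σ : ∀ i, RightComodule k C (S i)} {e : I → DualAlg k C}

/-- Every nonzero subcomodule contains a copy of one of the simple comodules `S i`. -/
lemma IsCompleteSetOfSimples.exists_hom_range_le (hσ : IsCompleteSetOfSimples σ) {M : Type v}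
    [AddCommGroup M] [Module k M] (ρ : RightComodule k C M) {X : Submodule k M}
    (hX : ρ.IsSubcomodule X) (h0 : X ≠ ⊥) :
    ∃ i, ∃ h ∈ (σ i).hom ρ, Function.Injective h ∧ LinearMap.range h ≤ X := by
  obtain ⟨T, hT, hTX, hs⟩ := ρ.exists_isSimple_le hX h0
  obtain ⟨i, φ, hφ⟩ := hσ.complete T (ρ.restrict T hT) hs
  refine ⟨i, T.subtype ∘ₗ φ.symm.toLinearMap, ?_, Subtype.val_injective.comp φ.symm.injective, ?_⟩
  · rw [mem_hom_iff] at hφ ⊢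
    intro f s
    obtain ⟨t, rfl⟩ := φ.surjective s
    rw [← LinearEquiv.coe_coe, ← hφ]
    simp [act_restrict]
  · rintro _ ⟨s, rfl⟩
    exact hTX (φ.symm s).2

variable [IsCocomm k C]

namespace IsBasicSetOfIdempotents

lemma act_eq_self (hσ : IsCompleteSetOfSimples σ) (he : IsBasicSetOfIdempotents σ e) (i : I)
    (s : S i) : (σ i).act (e i) s = s := by
  obtain ⟨f, hf, hinj, hle, -⟩ := exists_smallest_of_isInjectiveHull (hσ.simple i) (he.hull i)
  exact act_eq_self_of_range_le (he.orthogonal.idem i) hf hinj hle s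

lemma act_of_ne (hσ : IsCompleteSetOfSimples σ) (he : IsBasicSetOfIdempotents σ e) {i j : I}
    (hij : i ≠ j) (s : S j) : (σ j).act (e i) s = 0 := by
  rw [← he.act_eq_self hσ j s, ← act_mul, he.orthogonal.ortho hij, map_zero,
    LinearMap.zero_apply]

end IsBasicSetOfIdempotents

/-- Subtracting from `c` its finitely many nonzero components `e i c` leaves an element killed by
every `e i`, and so is its orbit. A simple subcomodule `S i` of that orbit would be both fixed and
killed by `e i`. -/
lemma IsBasicSetOfIdempotents.iSup_range_act (hσ : IsCompleteSetOfSimples σ)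
    (he : IsBasicSetOfIdempotents σ e) :
    ⨆ i, LinearMap.range ((regular k C).act (e i)) = ⊤ := by
  classical
  refine eq_top_iff.2 fun c _ => ?_
  let F := (finite_act_ne_zero he.orthogonal c).toFinset
  let d := ∑ i ∈ F, (regular k C).act (e i) c
  have hd : d ∈ ⨆ i, LinearMap.range ((regular k C).act (e i)) :=
    Submodule.sum_mem _ fun i _ => Submodule.mem_iSup_of_mem i ⟨c, rfl⟩
  have hkill : ∀ i, (regular k C).act (e i) (c - d) = 0 := by
    intro i
    rw [map_sub, map_sum, sub_eq_zero]
    by_cases hi : i ∈ F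
    · rw [Finset.sum_eq_single_of_mem i hi fun j _ hj =>
        act_eq_zero_of_ne he.orthogonal hj.symm ⟨c, rfl⟩]
      exact (act_eq_self_of_mem_range (he.orthogonal.idem i) ⟨c, rfl⟩).symm
    · rw [Finset.sum_eq_zero fun j hj => act_eq_zero_of_ne he.orthogonal
        (by rintro rfl; exact hi hj) ⟨c, rfl⟩]
      simpa [F] using hi
  suffices h : (regular k C).orbit (c - d) = ⊥ by
    have := h ▸ (regular k C).mem_orbit_self (c - d)
    rw [Submodule.mem_bot, sub_eq_zero] at this
    rwa [this]
  by_contra h0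
  obtain ⟨i, h, hh, hinj, hle⟩ := hσ.exists_hom_range_le _ (orbit_isSubcomodule _ _) h0
  obtain ⟨s, hs⟩ := @exists_ne _ (hσ.simple i).1 (0 : S i)
  apply hs
  apply hinj
  obtain ⟨f, hf⟩ := hle ⟨s, rfl⟩
  rw [map_zero, ← he.act_eq_self hσ i s, (mem_hom_iff _ _ _).1 hh, ← hf]
  change (regular k C).act (e i) ((regular k C).act f (c - d)) = 0
  rw [act_comm, hkill, map_zero]

/-- If `C` is strictly quasi-finite, then each `e i C` is artinian. -/
lemma IsBasicSetOfIdempotents.isArtinianBelow_of_isStrictlyQuasiFinite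
    (hσ : IsCompleteSetOfSimples σ) (he : IsBasicSetOfIdempotents σ e)
    (hC : IsStrictlyQuasiFiniteCoalgebra k C) (i : I) :
    IsArtinianBelow (LinearMap.range ((regular k C).act (e i))) := by
  refine (wellFoundedGT_dual_iff _).1 (wellFoundedGT_iff_monotone_chain_condition.2 fun Y' => ?_)
  let Y := fun n => OrderDual.ofDual (Y' n)
  have hanti : ∀ {m n}, m ≤ n → (Y n).1 ≤ (Y m).1 := fun hmn => Y'.monotone hmn
  have hY : ∀ n, (regular k C).IsSubcomodule (Y n).1 := fun n => (Y n).2.1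
  let X : Submodule k C := ⨅ n, (Y n).1
  have hX : (regular k C).IsSubcomodule X := by
    rw [isSubcomodule_iff]
    intro f x hx
    simp only [X, Submodule.mem_iInf] at hx ⊢
    exact fun n => ((regular k C).isSubcomodule_iff _).1 (hY n) f x (hx n)
  let τ := (regular k C).quotient X hX
  have := (hσ.simple i).finiteDimensional
  have := hC X hX (S i) (σ i) (hσ.simple i)
  -- The sum of all images of `S i` in `C / X`; it is a quotient of `Hom ⊗ S i`, hence
  -- finite-dimensional.
  let R : Submodule k (C ⧸ X) := LinearMap.range (TensorProduct.lift ((σ i).hom τ).subtype)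
  have hR : ∀ h ∈ (σ i).hom τ, LinearMap.range h ≤ R := by
    rintro h hh _ ⟨s, rfl⟩
    exact ⟨⟨h, hh⟩ ⊗ₜ s, by simp⟩
  obtain ⟨n, hn⟩ := WellFoundedLT.antitone_chain_condition
    (f := fun n => ((Y n).1.map X.mkQ).comap R.subtype)
    fun m n hmn => Submodule.comap_mono (Submodule.map_mono (hanti hmn))
  have hle : (Y n).1 ≤ X := by
    suffices h : (Y n).1.map X.mkQ = ⊥ by
      rwa [← X.ker_mkQ, LinearMap.le_ker_iff_map]
    by_contra h0
    obtain ⟨j, h, hh, hinj, hrange⟩ := hσ.exists_hom_range_le τ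
      (isSubcomodule_map (mkQ_mem_hom _ X hX) (hY n)) h0
    obtain ⟨s, hs⟩ := @exists_ne _ (hσ.simple j).1 (0 : S j)
    obtain ⟨c, hc, hcs⟩ := hrange ⟨s, rfl⟩
    -- On `Y n` the idempotent `e i` is the identity, while it kills `S j` for `j ≠ i`.
    have hij : i = j := by
      by_contra hij
      refine hs (hinj ?_)
      rw [map_zero, ← hcs, ← act_eq_self_of_mem_range (he.orthogonal.idem i) ((Y n).2.2 hc),
        ← act_quotient _ X hX, hcs, ← (mem_hom_iff _ _ _).1 hh, he.act_of_ne hσ hij, map_zero]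
    subst hij
    have hsR : h s ∈ R := hR h hh ⟨s, rfl⟩
    have hsZ : ∀ m, n ≤ m → h s ∈ (Y m).1.map X.mkQ := by
      intro m hm
      have : (⟨h s, hsR⟩ : R) ∈ ((Y n).1.map X.mkQ).comap R.subtype := ⟨c, hc, hcs⟩
      exact (hn m hm).le this
    -- After stage `n` the traces on `R` are constant, so each `Y m` meets the class of `c`; as `X ≤
    -- Y m`, it contains `c`.
    have hcX : c ∈ X := by
      refine (Submodule.mem_iInf _).2 fun m => ?_
      obtain ⟨b, hb, hbs⟩ := hsZ (max n m) (le_max_left _ _)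
      have hbc : b - c ∈ X := (Submodule.Quotient.eq X).1 (hbs.trans hcs.symm)
      have hbm : b ∈ (Y m).1 := hanti (le_max_right n m) hb
      simpa using sub_mem hbm ((Submodule.mem_iInf _).1 hbc m)
    refine hs (hinj ?_)
    rw [map_zero, ← hcs]
    exact (Submodule.Quotient.mk_eq_zero X).2 hcX
  exact ⟨n, fun m hm => congrArg OrderDual.toDual (Subtype.ext (a1 := Y n) (a2 := Y m)
    (le_antisymm (hle.trans (iInf_le _ m)) (hanti hm)))⟩

end BasicIdempotents

/-! ### The equivalence. -/

theorem mainTheorem10 {k : Type u} {C : Type v} [Field k] [AddCommGroup C] [Module k C]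
    [Coalgebra k C] [IsCocomm k C] {I : Type w} {S : I → Type v} [∀ i, AddCommGroup (S i)]
    [∀ i, Module k (S i)] (σ : ∀ i, RightComodule k C (S i)) (hσ : IsCompleteSetOfSimples σ)
    (e : I → DualAlg k C) (he : IsBasicSetOfIdempotents σ e) :
    List.TFAE [
      IsStrictlyQuasiFiniteCoalgebra k C,
      ∀ i, IsArtinianCoalgebra k (Corner (e i) (he.orthogonal.idem i)),
      IsDirectSumOfArtinianColocal k C,
      ∀ i, IsNoetherianRing (DualAlg k (Corner (e i) (he.orthogonal.idem i)))] := by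
  have hsmall : ∀ i, ∃ x : C, x ≠ 0 ∧ x ∈ LinearMap.range ((regular k C).act (e i)) ∧
      ∀ X : Submodule k C, (regular k C).IsSubcomodule X →
        X ≤ LinearMap.range ((regular k C).act (e i)) → X ≠ ⊥ → x ∈ X := by
    intro i
    obtain ⟨f, hf, hinj, hle, hmin⟩ :=
      exists_smallest_of_isInjectiveHull (hσ.simple i) (he.hull i)
    obtain ⟨s, hs⟩ := @exists_ne _ (hσ.simple i).1 (0 : S i)
    exact ⟨f s, fun h0 => hs (hinj (h0.trans (map_zero f).symm)), hle ⟨s, rfl⟩,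
      fun X hX hXe hX0 => hmin X hX hXe hX0 ⟨s, rfl⟩⟩
  tfae_have 1 → 2 := fun h i => (Corner.isArtinianCoalgebra_iff _ _).2
    (he.isArtinianBelow_of_isStrictlyQuasiFinite hσ h i)
  tfae_have 2 → 1 := by
    intro h X hX T _ _ τ hτ
    obtain ⟨i, φ, hφ⟩ := hσ.complete T τ hτ
    have := hτ.finiteDimensional
    refine finiteDimensional_hom_quotient ((Corner.isArtinianCoalgebra_iff _ _).1 (h i))
      (fun t => φ.injective ?_) X hX
    exact ((mem_hom_iff _ _ _).1 hφ (e i) t).trans (he.act_eq_self hσ i (φ t))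
  tfae_have 2 → 3 := by
    intro h
    -- The summands must be indexed in the universe of `C`, where `I` need not live; the set of
    -- subspaces `e i C` serves instead, with one chosen index for each.
    let R : I → Submodule k C := fun i => LinearMap.range ((regular k C).act (e i))
    let idx : Set.range R → I := fun j => j.2.choose
    have hidx : ∀ j, R (idx j) = j := fun j => j.2.choose_spec
    have hinj : Function.Injective idx := fun a b hab =>
      Subtype.ext (by rw [← hidx a, ← hidx b, hab])
    have hort : OrthogonalIdempotents (e ∘ idx) := he.orthogonal.embedding ⟨idx, hinj⟩
    have htop : ⨆ j, LinearMap.range ((regular k C).act ((e ∘ idx) j)) = ⊤ := by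
      rw [eq_top_iff, ← he.iSup_range_act hσ]
      exact iSup_le fun i => (hidx ⟨R i, i, rfl⟩).ge.trans
        (le_iSup (fun j => R (idx j)) (⟨R i, i, rfl⟩ : Set.range R))
    refine ⟨Set.range R, fun j => Corner (e (idx j)) (he.orthogonal.idem (idx j)),
      inferInstance, inferInstance, inferInstance, inferInstance, fun j => h _, fun j => ?_,
      nonempty_coalgEquiv_dfinsupp_corner hort htop⟩
    obtain ⟨x, hx, hxe, hmin⟩ := hsmall (idx j)
    exact Corner.isColocalCoalgebra _ _ hx hmin hxe
  tfae_have 3 → 2 := by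
    classical
    rintro ⟨J, D, _, _, _, -, hD, -, ⟨φ⟩⟩ i
    obtain ⟨x, hx, -, hmin⟩ := hsmall i
    exact (Corner.isArtinianCoalgebra_iff _ _).2 (isArtinianBelow_of_coalgEquiv φ hD
      (isSubcomodule_range (act_mem_hom _ _)) hx hmin)
  tfae_have 2 ↔ 4 := forall_congr' fun i => isNoetherianRing_dualAlg_iff.symm
  tfae_finish
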